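/- Let $\mathbb{X}$ be a semi-abelian category, that is, a pointed category which is Barr exact (finitely complete, regular, and such that every internal equivalence relation is a kernel pair), Bourn protomodular, and has binary coproducts. For an object $B$ let $\mathsf{Pt}_B(\mathbb{X})$ be the category of points over $B$, i.e. of split epimorphisms $p\colon A\to B$ with a chosen section $s\colon B\to A$, with morphisms over $B$ compatible with the sections, and let $(\mathbb{X}\downarrow B)$ be the slice category over $B$. Each $p\colon E\to B$ induces, by pulling back, change of base functors $p^*\colon \mathsf{Pt}_B(\mathbb{X})\to\mathsf{Pt}_E(\mathbb{X})$ (of the fibration of points) and $p^*\colon(\mathbb{X}\downarrow B)\to(\mathbb{X}\downarrow E)$ (of the basic fibration $\mathsf{Arr}(\mathbb{X})\to\mathbb{X}$); protomodularity means that all the functors $p^*\colon \mathsf{Pt}_B(\mathbb{X})\to\mathsf{Pt}_E(\mathbb{X})$ reflect isomorphisms. Two morphisms $k\colon K\to X$, $l\colon L\to X$ in a pointed category with binary products commute (in the sense of Huq) if there is $\varphi\colon K\times L\to X$ with $\varphi\langle 1_K,0\rangle=k$ and $\varphi\langle 0,1_L\rangle=l$; a normal subobject is a kernel. Two equivalence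 relations $(r_1,r_2)\colon R\rightrightarrows X$ and $(s_1,s_2)\colon S\rightrightarrows X$ centralise each other (commute in the sense of Smith) if there is a morphism $\theta\colon R\times_X S\to X$, where $R\times_XS$ is the pullback of $r_2$ and $s_1$, such that $\theta(x,y,y)=x$ and $\theta(x,x,z)=z$ for generalised elements. The normalisation of $(r_1,r_2)$ is the composite of $\ker(r_1)\colon \mathrm{Ker}(r_1)\to R$ with $r_2\colon R\to X$. Then the following conditions are equivalent: (i) the Smith is Huq condition (SH): any two equivalence relations on the same object of $\mathbb{X}$ centralise each other as soon as their normalisations commute; (ii) condition (C): for every $p\colon E\to B$ in $\mathbb{X}$, the functor $p^*\colon \mathsf{Pt}_B(\mathbb{X})\to\mathsf{Pt}_E(\mathbb{X})$ reflects the commutation of normal subobjects; (iii) condition ($\overline{\mathrm{C}}$): for every $p\colon E\to B$ in $\mathbb{X}$, the functor $p^*\colon \mathsf{Pt}_B(\mathbb{X})\to\mathsf{Pt}_E(\mathbb{X})$ reflects the centralisation of equivalence relations; (iv) for every $p\colon E\to B$ in $\mathbb{X}$, the functor $p^*\colon (\mathbb{X}\downarrow B)\to(\mathbb{X}\downarrow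 E)$ reflects the centralisation of equivalence relations. -/

import Mathlib

open CategoryTheory CategoryTheory.Limits

universe v u

namespace SmithHuq

section Points

variable {C : Type u} [Category.{v} C]

/-- A point over `B`: a split epimorphism `p : A ⟶ B` with a chosen section `s`. -/
structure Pt (B : C) where
  /-- the domain of the split epimorphism -/
  A : C
  /-- the split epimorphism -/
  p : A ⟶ B
  /-- the chosen section -/
  s : B ⟶ A
  s_p : s ≫ p = 𝟙 B

namespace Pt

attribute [simp] Pt.s_p

/-- A morphism of points over `B` commutes with the split epimorphisms and with the sections. -/
@[ext]
structure Hom {B : C} (X Y : Pt B) where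
  /-- the underlying morphism -/
  hom : X.A ⟶ Y.A
  w_p : hom ≫ Y.p = X.p
  w_s : X.s ≫ hom = Y.s

attribute [simp] Hom.w_p Hom.w_s

/-- The category `Pt_B(C)` of points over `B`. -/
instance category (B : C) : Category.{v} (Pt B) where
  Hom X Y := Hom X Y
  id X := ⟨𝟙 X.A, by simp, by simp⟩
  comp f g := ⟨f.hom ≫ g.hom, by simp, by rw [← Category.assoc]; simp⟩
  id_comp _ := Hom.ext (Category.id_comp _)
  comp_id _ := Hom.ext (Category.comp_id _)
  assoc _ _ _ := Hom.ext (Category.assoc _ _ _)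

/-- `Pt_B(C)` is pointed, with zero object `(B, 𝟙 B, 𝟙 B)`: the zero morphism from `(A, p, s)` to
`(A', p', s')` is the composite of `p` with `s'`. -/
instance hasZeroMorphisms (B : C) : HasZeroMorphisms (Pt B) where
  zero X Y := ⟨⟨X.p ≫ Y.s, by simp, by rw [← Category.assoc]; simp⟩⟩
  comp_zero {X Y} f Z := Hom.ext (show f.hom ≫ Y.p ≫ Z.s = X.p ≫ Z.s by
    rw [← Category.assoc, f.w_p])
  zero_comp X {Y Z} f := Hom.ext (show (X.p ≫ Y.s) ≫ f.hom = X.p ≫ Z.s by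
    rw [Category.assoc, f.w_s])

/-- The pullback of a point over `B` along `p : E ⟶ B`. -/
@[simps]
noncomputable def changeOfBaseObj [HasPullbacks C] {E B : C} (p : E ⟶ B) (X : Pt B) : Pt E where
  A := pullback X.p p
  p := pullback.snd X.p p
  s := pullback.lift (p ≫ X.s) (𝟙 E) (by simp)
  s_p := pullback.lift_snd _ _ _

/-- The morphism induced on pullbacks along `p : E ⟶ B` by a morphism of points over `B`. -/
noncomputable def pullbackMap [HasPullbacks C] {E B : C} (p : E ⟶ B) {X Y : Pt B} (f : X ⟶ Y) :
    pullback X.p p ⟶ pullback Y.p p :=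
  pullback.lift (pullback.fst X.p p ≫ f.hom) (pullback.snd X.p p)
    (by rw [Category.assoc, f.w_p, pullback.condition])

@[simp]
lemma pullbackMap_fst [HasPullbacks C] {E B : C} (p : E ⟶ B) {X Y : Pt B} (f : X ⟶ Y) :
    pullbackMap p f ≫ pullback.fst Y.p p = pullback.fst X.p p ≫ f.hom :=
  pullback.lift_fst _ _ _

@[simp]
lemma pullbackMap_snd [HasPullbacks C] {E B : C} (p : E ⟶ B) {X Y : Pt B} (f : X ⟶ Y) :
    pullbackMap p f ≫ pullback.snd Y.p p = pullback.snd X.p p :=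
  pullback.lift_snd _ _ _

/-- The change of base functor `p^* : Pt_B(C) ⥤ Pt_E(C)` of the fibration of points along
`p : E ⟶ B`, given by pulling back. -/
noncomputable def changeOfBase [HasPullbacks C] {E B : C} (p : E ⟶ B) : Pt B ⥤ Pt E where
  obj X := changeOfBaseObj p X
  map {X Y} f :=
    { hom := pullbackMap p f
      w_p := pullbackMap_snd p f
      w_s := by
        change pullback.lift (p ≫ X.s) (𝟙 E) _ ≫ pullbackMap p f = pullback.lift (p ≫ Y.s) (𝟙 E) _
        apply pullback.hom_ext
        · rw [Category.assoc, pullbackMap_fst, pullback.lift_fst_assoc, pullback.lift_fst,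
            Category.assoc, f.w_s]
        · rw [Category.assoc, pullbackMap_snd, pullback.lift_snd, pullback.lift_snd] }
  map_id X := by
    apply Hom.ext
    change pullbackMap p (𝟙 X) = 𝟙 (pullback X.p p)
    apply pullback.hom_ext
    · rw [pullbackMap_fst, Category.id_comp]
      exact Category.comp_id _
    · rw [pullbackMap_snd, Category.id_comp]
  map_comp {X Y Z} f g := by
    apply Hom.ext
    change pullbackMap p (f ≫ g) = pullbackMap p f ≫ pullbackMap p g
    apply pullback.hom_ext
    · rw [Category.assoc, pullbackMap_fst, pullbackMap_fst, ← Category.assoc, pullbackMap_fst,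
        Category.assoc]
      rfl
    · rw [Category.assoc, pullbackMap_snd, pullbackMap_snd, pullbackMap_snd]

end Pt

end Points

/-- A semi-abelian category: pointed, Barr exact (regular, with every equivalence relation a
kernel pair), Bourn protomodular (every change of base functor of the fibration of points reflects
isomorphisms), with binary coproducts. Finite completeness is part of `Regular`. -/
class SemiAbelian (C : Type u) [Category.{v} C] : Prop
    extends Regular C, HasZeroObject C, HasBinaryCoproducts C where
  exact : ∀ {R X : C} (r₁ r₂ : R ⟶ X), IsEquivalenceRelation r₁ r₂ →
    ∃ (Y : C) (f : X ⟶ Y), IsKernelPair f r₁ r₂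
  protomodular : ∀ {E B : C} (p : E ⟶ B), (Pt.changeOfBase p).ReflectsIsomorphisms

section Commutation

variable {C : Type u} [Category.{v} C]

/-- The relations `(r₁, r₂) : R ⇉ X` and `(s₁, s₂) : S ⇉ X` centralise each other (commute in the
sense of Smith): there is a connector, that is, a morphism `θ : R ×_X S ⟶ X` on the object of
triples `(x, y, z)` with `x R y` and `y S z`, such that `θ (x, y, y) = x` and `θ (x, x, z) = z`.
The two equations are expressed on generalised elements `t : T ⟶ R ×_X S`. -/
def Centralise {R S X : C} (r₁ r₂ : R ⟶ X) (s₁ s₂ : S ⟶ X) : Prop :=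
  ∃ (P : C) (π₁ : P ⟶ R) (π₂ : P ⟶ S) (_ : IsPullback π₁ π₂ r₂ s₁) (θ : P ⟶ X),
    (∀ ⦃T : C⦄ (t : T ⟶ P), t ≫ π₂ ≫ s₁ = t ≫ π₂ ≫ s₂ → t ≫ θ = t ≫ π₁ ≫ r₁) ∧
    (∀ ⦃T : C⦄ (t : T ⟶ P), t ≫ π₁ ≫ r₁ = t ≫ π₁ ≫ r₂ → t ≫ θ = t ≫ π₂ ≫ s₂)

/-- `k : K ⟶ X` and `l : L ⟶ X` commute in the sense of Huq: there is `φ : K × L ⟶ X` which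
restricts to `k` along `⟨1, 0⟩ : K ⟶ K × L` and to `l` along `⟨0, 1⟩ : L ⟶ K × L`. -/
def HuqCommute [HasZeroMorphisms C] {K L X : C} (k : K ⟶ X) (l : L ⟶ X) : Prop :=
  ∃ (P : C) (π₁ : P ⟶ K) (π₂ : P ⟶ L) (h : IsLimit (BinaryFan.mk π₁ π₂)) (φ : P ⟶ X),
    h.lift (BinaryFan.mk (𝟙 K) (0 : K ⟶ L)) ≫ φ = k ∧
    h.lift (BinaryFan.mk (0 : L ⟶ K) (𝟙 L)) ≫ φ = l

/-- The normalisation of the relation `(r₁, r₂) : R ⇉ X`: the morphism `Ker r₁ ⟶ R ⟶ X`, the last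
arrow being `r₂`. -/
noncomputable def normalisation [HasZeroMorphisms C] [HasKernels C] {R X : C} (r₁ r₂ : R ⟶ X) :
    kernel r₁ ⟶ X :=
  kernel.ι r₁ ≫ r₂

end Commutation

section Reflection

universe v' u'

variable {C : Type u} [Category.{v} C] {D : Type u'} [Category.{v'} D]

/-- The functor `F` reflects the centralisation of equivalence relations. -/
def ReflectsCentralisation (F : C ⥤ D) : Prop :=
  ∀ ⦃R S X : C⦄ (r₁ r₂ : R ⟶ X) (s₁ s₂ : S ⟶ X),
    IsEquivalenceRelation r₁ r₂ → IsEquivalenceRelation s₁ s₂ →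
    Centralise (F.map r₁) (F.map r₂) (F.map s₁) (F.map s₂) → Centralise r₁ r₂ s₁ s₂

/-- The functor `F` reflects the (Huq) commutation of normal subobjects, i.e. of kernels. -/
def ReflectsNormalCommutation [HasZeroMorphisms C] [HasZeroMorphisms D] (F : C ⥤ D) : Prop :=
  ∀ ⦃K L X : C⦄ (k : K ⟶ X) (l : L ⟶ X),
    Nonempty (NormalMono k) → Nonempty (NormalMono l) →
    HuqCommute (F.map k) (F.map l) → HuqCommute k l

end Reflection

section Conditions

variable (C : Type u) [Category.{v} C]

/-- The Smith is Huq condition (SH): two equivalence relations on the same object centralise each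
other as soon as their normalisations commute. -/
def SmithIsHuq [HasZeroMorphisms C] [HasKernels C] : Prop :=
  ∀ ⦃R S X : C⦄ (r₁ r₂ : R ⟶ X) (s₁ s₂ : S ⟶ X),
    IsEquivalenceRelation r₁ r₂ → IsEquivalenceRelation s₁ s₂ →
    HuqCommute (normalisation r₁ r₂) (normalisation s₁ s₂) → Centralise r₁ r₂ s₁ s₂

/-- Condition (C): change of base for the fibration of points reflects the commutation of normal
subobjects. -/
def ConditionC [HasPullbacks C] : Prop :=
  ∀ ⦃E B : C⦄ (p : E ⟶ B), ReflectsNormalCommutation (Pt.changeOfBase p)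

/-- Condition (C̄): change of base for the fibration of points reflects the centralisation of
equivalence relations. -/
def ConditionCBar [HasPullbacks C] : Prop :=
  ∀ ⦃E B : C⦄ (p : E ⟶ B), ReflectsCentralisation (Pt.changeOfBase p)

/-- Change of base for the basic fibration (the codomain functor `Arr(C) ⥤ C`, with fibres the
slice categories) reflects the centralisation of equivalence relations. -/
def BasicReflectsCentralisation [HasPullbacks C] : Prop :=
  ∀ ⦃E B : C⦄ (p : E ⟶ B), ReflectsCentralisation (Over.pullback p)

end Conditions

end SmithHuq

namespace SmithHuq

-- The scheme is (SH) ⇔ (C) together with (SH) ⇒ (iv) ⇒ (C̄) ⇒ (SH). Protomodularity enters mostly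
-- through `Pt.eq_of_fibre`: in a point, the section and any fibre of the projection are jointly
-- epic. It makes every connector compatible with maps coequalising both relations
-- (`connector_comp_eq`), so connectors found in the base category lift to slices and to categories
-- of points.
--
-- From (SH): an element of a normalisation lies over 0, so it lifts along any `p` by the zero map.
-- Commutation or centralisation after pulling back therefore makes the normalisations commute. (SH)
-- then gives a connector θ, and for normal subobjects of a point (A, p, s) the Huq morphism is (k,
-- l) ↦ θ(k, s p k, l).
--
-- Towards (SH), only change of base along 0 → X is needed, and exactness presents the relations as
-- kernel pairs of f and g. From (C): a relation R on X is a normal subobject of X × X in points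
-- over X, with its normalisation as fibre over 0; a Huq morphism for R and S becomes a connector
-- once R is reversed. From (C̄): the triples (x, y, z) with x R y S z form a point over X by x,
-- whose fibre over 0 is isomorphic to a product of commuting kernels. There the kernel pairs of f
-- and g applied to z centralise each other coordinatewise (`centralise_of_commuting_kernels`). (C̄)
-- extends this to all triples, and evaluating at (x,x,x), (x,y,y), (x,y,z) gives the connector of R
-- and S.

attribute [simp] pullback.lift_fst pullback.lift_snd pullback.lift_fst_assoc
  pullback.lift_snd_assoc prod.lift_fst prod.lift_snd prod.lift_fst_assoc prod.lift_snd_assoc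

/-! ### Limits in categories of points, computed in the base category. -/

namespace Pt

section Basic

variable {C : Type u} [Category.{v} C] {B : C}

@[simp]
lemma comp_hom {X Y Z : Pt B} (f : X ⟶ Y) (g : Y ⟶ Z) : (f ≫ g).hom = f.hom ≫ g.hom := rfl

@[simp]
lemma id_hom (X : Pt B) : Hom.hom (𝟙 X) = 𝟙 X.A := rfl

@[ext]
lemma hom_ext {X Y : Pt B} {f g : X ⟶ Y} (h : f.hom = g.hom) : f = g := Hom.ext h

/-- Constructor for morphisms of points. -/
@[simps]
def homMk {X Y : Pt B} (f : X.A ⟶ Y.A) (w_p : f ≫ Y.p = X.p) (w_s : X.s ≫ f = Y.s) : X ⟶ Y :=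
  Hom.mk f w_p w_s

@[simp]
lemma hom_p {X Y : Pt B} (f : X ⟶ Y) : f.hom ≫ Y.p = X.p := f.w_p

@[simp]
lemma hom_p_assoc {X Y : Pt B} (f : X ⟶ Y) {Z : C} (h : B ⟶ Z) :
    f.hom ≫ Y.p ≫ h = X.p ≫ h := by
  rw [← Category.assoc, hom_p]

@[simp]
lemma s_hom {X Y : Pt B} (f : X ⟶ Y) : X.s ≫ f.hom = Y.s := f.w_s

@[simp]
lemma s_hom_assoc {X Y : Pt B} (f : X ⟶ Y) {Z : C} (h : Y.A ⟶ Z) :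
    X.s ≫ f.hom ≫ h = Y.s ≫ h := by
  rw [← Category.assoc, s_hom]

@[simp]
lemma s_p_assoc (X : Pt B) {Z : C} (h : B ⟶ Z) : X.s ≫ X.p ≫ h = h := by
  rw [← Category.assoc, X.s_p, Category.id_comp]

variable (B) in
/-- The functor forgetting the section of a point. -/
@[simps]
def toOver : Pt B ⥤ Over B where
  obj X := Over.mk X.p
  map f := Over.homMk f.hom f.w_p

variable (B) in
/-- The functor sending a point to its domain. -/
@[simps]
def forget : Pt B ⥤ C where
  obj X := X.A
  map f := f.hom

lemma isPullback_of_hom {P X Y Z : Pt B} {a : P ⟶ X} {b : P ⟶ Y} {f : X ⟶ Z} {g : Y ⟶ Z}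
    (h : IsPullback a.hom b.hom f.hom g.hom) : IsPullback a b f g where
  w := hom_ext h.w
  isLimit' := ⟨PullbackCone.IsLimit.mk _
    (fun s ↦ homMk (h.lift s.fst.hom s.snd.hom congr(Hom.hom $s.condition))
      (by rw [← hom_p a, h.lift_fst_assoc, hom_p])
      (h.hom_ext (by rw [Category.assoc, h.lift_fst, s_hom, s_hom])
        (by rw [Category.assoc, h.lift_snd, s_hom, s_hom])))
    (fun s ↦ hom_ext (h.lift_fst _ _ _)) (fun s ↦ hom_ext (h.lift_snd _ _ _))
    (fun s m h₁ h₂ ↦ hom_ext (h.hom_ext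
      ((congr(Hom.hom $h₁)).trans (h.lift_fst _ _ _).symm)
      ((congr(Hom.hom $h₂)).trans (h.lift_snd _ _ _).symm)))⟩

/-- The point with trivial kernel, a zero object of the category of points. -/
@[simps]
def trivial (B : C) : Pt B where
  A := B
  p := 𝟙 B
  s := 𝟙 B
  s_p := by simp

/-- The trivial point is terminal. -/
def trivialIsTerminal (B : C) : IsTerminal (trivial B) :=
  IsTerminal.ofUniqueHom (fun X ↦ homMk X.p (Category.comp_id _) X.s_p) (fun X m ↦ hom_ext (by
    exact (Category.comp_id _).symm.trans (hom_p m)))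

end Basic

section Pullbacks

variable {C : Type u} [Category.{v} C] [HasPullbacks C] {B : C}

/-- The pullback of morphisms of points. -/
@[simps]
noncomputable def pullbackObj {X Y Z : Pt B} (f : X ⟶ Z) (g : Y ⟶ Z) : Pt B where
  A := pullback f.hom g.hom
  p := pullback.fst f.hom g.hom ≫ X.p
  s := pullback.lift X.s Y.s (by simp)
  s_p := by rw [pullback.lift_fst_assoc, X.s_p]

lemma exists_isPullback_hom {X Y Z : Pt B} (f : X ⟶ Z) (g : Y ⟶ Z) :
    ∃ (P : Pt B) (a : P ⟶ X) (b : P ⟶ Y), IsPullback a.hom b.hom f.hom g.hom :=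
  ⟨pullbackObj f g, homMk (pullback.fst f.hom g.hom) rfl (pullback.lift_fst _ _ _),
    homMk (pullback.snd f.hom g.hom)
      (by
        change _ = pullback.fst f.hom g.hom ≫ X.p
        rw [← hom_p f, pullback.condition_assoc, hom_p]
        rfl)
      (pullback.lift_snd _ _ _), IsPullback.of_hasPullback f.hom g.hom⟩

instance : HasPullbacks (Pt B) :=
  have {X Y Z : Pt B} {f : X ⟶ Z} {g : Y ⟶ Z} : HasLimit (cospan f g) := by
    obtain ⟨P, a, b, h⟩ := exists_isPullback_hom f g
    exact (isPullback_of_hom h).hasPullback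
  hasPullbacks_of_hasLimit_cospan _

instance : PreservesLimitsOfShape WalkingCospan (forget B) where
  preservesLimit {K} := by
    suffices PreservesLimit (cospan (K.map WalkingCospan.Hom.inl) (K.map WalkingCospan.Hom.inr))
        (forget B) from preservesLimit_of_iso_diagram _ (diagramIsoCospan K).symm
    obtain ⟨P, a, b, h⟩ := exists_isPullback_hom (K.map WalkingCospan.Hom.inl)
      (K.map WalkingCospan.Hom.inr)
    have h' := isPullback_of_hom h
    exact preservesLimit_of_preserves_limit_cone h'.isLimit
      ((isLimitMapConePullbackConeEquiv (forget B) h'.w).symm (IsPullback.isLimit h))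

instance : PreservesLimitsOfShape WalkingCospan (toOver B) :=
  have : PreservesLimitsOfShape WalkingCospan (toOver B ⋙ Over.forget B) :=
    inferInstanceAs (PreservesLimitsOfShape WalkingCospan (forget B))
  have : ReflectsLimitsOfShape WalkingCospan (Over.forget B) :=
    reflectsLimitsOfShape_of_reflectsIsomorphisms
  preservesLimitsOfShape_of_reflects_of_preserves (toOver B) (Over.forget B)

instance : (forget B).ReflectsIsomorphisms where
  reflects {X Y} f hf := by
    have : IsIso f.hom := hf
    exact ⟨homMk (inv f.hom) (by rw [IsIso.inv_comp_eq, hom_p]) (by rw [IsIso.comp_inv_eq, s_hom]),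
      hom_ext (by simp), hom_ext (by simp)⟩

lemma isPullback_hom {P X Y Z : Pt B} {a : P ⟶ X} {b : P ⟶ Y} {f : X ⟶ Z} {g : Y ⟶ Z}
    (h : IsPullback a b f g) : IsPullback a.hom b.hom f.hom g.hom :=
  h.map (forget B)

/-- The zero object of points over `B` is `trivial B`, so a kernel is a pullback along the zero
section, and forgetting to `C` preserves pullbacks. -/
lemma isPullback_of_isKernel {K X Y : Pt B} {k : K ⟶ X} {u : X ⟶ Y} {w : k ≫ u = 0}
    (h : IsLimit (KernelFork.ofι k w)) : IsPullback k.hom K.p u.hom Y.s := by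
  have hp : IsPullback k (homMk K.p (Category.comp_id _) K.s_p : K ⟶ trivial B) u
      (homMk Y.s Y.s_p (Category.id_comp _)) :=
    ⟨⟨hom_ext congr(Hom.hom $w)⟩, ⟨PullbackCone.IsLimit.mk _
      (fun s ↦ h.lift (KernelFork.ofι s.fst (by
        rw [s.condition]
        exact hom_ext (congr($(hom_p s.snd) ≫ Y.s).symm.trans
          (congr($(Category.comp_id _) ≫ Y.s))).symm)))
      (fun s ↦ h.fac _ WalkingParallelPair.zero)
      (fun s ↦ (trivialIsTerminal B).hom_ext _ _)
      (fun s m h₁ _ ↦ Fork.IsLimit.hom_ext h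
        (h₁.trans (h.fac (KernelFork.ofι s.fst _) WalkingParallelPair.zero).symm))⟩⟩
  exact isPullback_hom hp

lemma isPullback_of_isLimit_binaryFan {P K L : Pt B} {a : P ⟶ K} {b : P ⟶ L}
    (h : IsLimit (BinaryFan.mk a b)) : IsPullback a.hom b.hom K.p L.p :=
  isPullback_hom (IsPullback.of_is_product' h (trivialIsTerminal B))

end Pullbacks

end Pt

/-! ### Connectors described by their values on (x, y, y) and (y, y, z). -/

section Centralise

variable {C : Type u} [Category.{v} C] {R S X P : C} {r₁ r₂ : R ⟶ X} {s₁ s₂ : S ⟶ X}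
  {π₁ : P ⟶ R} {π₂ : P ⟶ S}

lemma Centralise.exists_connector (h : Centralise r₁ r₂ s₁ s₂) (hP : IsPullback π₁ π₂ r₂ s₁) :
    ∃ θ : P ⟶ X,
      (∀ ⦃T : C⦄ (t : T ⟶ P), t ≫ π₂ ≫ s₁ = t ≫ π₂ ≫ s₂ → t ≫ θ = t ≫ π₁ ≫ r₁) ∧
      (∀ ⦃T : C⦄ (t : T ⟶ P), t ≫ π₁ ≫ r₁ = t ≫ π₁ ≫ r₂ → t ≫ θ = t ≫ π₂ ≫ s₂) := by
  obtain ⟨P', π₁', π₂', hP', θ, h₁, h₂⟩ := h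
  refine ⟨hP'.lift π₁ π₂ hP.w ≫ θ, fun T t ht ↦ ?_, fun T t ht ↦ ?_⟩
  · rw [← Category.assoc, h₁ _ (by simpa using ht)]
    simp
  · rw [← Category.assoc, h₂ _ (by simpa using ht)]
    simp

/-- Joint monicity forces a generalised triple with equal last entries to factor through `i`, and
one with equal first entries through `j`. The two equations for all generalised elements thus reduce
to one on each leg. -/
lemma Centralise.of_legs [JointlyMono₂ r₁ r₂] [JointlyMono₂ s₁ s₂]
    (hP : IsPullback π₁ π₂ r₂ s₁) {i : R ⟶ P} {j : S ⟶ P}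
    (i₁ : i ≫ π₁ = 𝟙 R) (i₂ : i ≫ π₂ ≫ s₂ = r₂) (j₁ : j ≫ π₁ ≫ r₁ = s₁) (j₂ : j ≫ π₂ = 𝟙 S)
    (θ : P ⟶ X) (hi : i ≫ θ = r₁) (hj : j ≫ θ = s₂) : Centralise r₁ r₂ s₁ s₂ := by
  refine ⟨P, π₁, π₂, hP, θ, fun T t ht ↦ ?_, fun T t ht ↦ ?_⟩
  · have : t = (t ≫ π₁) ≫ i := by
      refine hP.hom_ext (by simp [i₁]) (JointlyMono₂.right_cancellation (p₁ := s₁) (p₂ := s₂) _ _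
        ?_ ?_)
      · simp only [Category.assoc, ← hP.w, reassoc_of% i₁]
      · simp only [Category.assoc, i₂, ← ht, hP.w]
    rw [this, Category.assoc, hi]
    simp [reassoc_of% i₁]
  · have : t = (t ≫ π₂) ≫ j := by
      refine hP.hom_ext (JointlyMono₂.right_cancellation (p₁ := r₁) (p₂ := r₂) _ _ ?_ ?_)
        (by simp [j₂])
      · simp only [Category.assoc, j₁, ht, hP.w]
      · simp only [Category.assoc, hP.w, reassoc_of% j₂]
    rw [this, Category.assoc, hj]
    simp [reassoc_of% j₂]

/-- The inclusion `(x, y) ↦ (x, y, y)` of `R` into the pullback `R ×_X S`. -/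
noncomputable def leftLeg (hP : IsPullback π₁ π₂ r₂ s₁) (hs : ReflexiveRelation s₁ s₂) : R ⟶ P :=
  hP.lift (𝟙 R) (r₂ ≫ hs.r) (by simp)

/-- The inclusion `(y, z) ↦ (y, y, z)` of `S` into the pullback `R ×_X S`. -/
noncomputable def rightLeg (hP : IsPullback π₁ π₂ r₂ s₁) (hr : ReflexiveRelation r₁ r₂) : S ⟶ P :=
  hP.lift (s₁ ≫ hr.r) (𝟙 S) (by simp)

section

variable (hP : IsPullback π₁ π₂ r₂ s₁) (hr : ReflexiveRelation r₁ r₂)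
  (hs : ReflexiveRelation s₁ s₂)

@[simp]
lemma leftLeg_fst : leftLeg hP hs ≫ π₁ = 𝟙 R := hP.lift_fst _ _ _

@[simp]
lemma leftLeg_fst_assoc {W : C} (h : R ⟶ W) : leftLeg hP hs ≫ π₁ ≫ h = h := by
  rw [← Category.assoc, leftLeg_fst]
  simp

@[simp]
lemma leftLeg_snd : leftLeg hP hs ≫ π₂ = r₂ ≫ hs.r := hP.lift_snd _ _ _

@[simp]
lemma leftLeg_snd_assoc {W : C} (h : S ⟶ W) : leftLeg hP hs ≫ π₂ ≫ h = r₂ ≫ hs.r ≫ h := by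
  rw [← Category.assoc, leftLeg_snd]
  simp

@[simp]
lemma rightLeg_fst : rightLeg hP hr ≫ π₁ = s₁ ≫ hr.r := hP.lift_fst _ _ _

@[simp]
lemma rightLeg_fst_assoc {W : C} (h : R ⟶ W) : rightLeg hP hr ≫ π₁ ≫ h = s₁ ≫ hr.r ≫ h := by
  rw [← Category.assoc, rightLeg_fst]
  simp

@[simp]
lemma rightLeg_snd : rightLeg hP hr ≫ π₂ = 𝟙 S := hP.lift_snd _ _ _

@[simp]
lemma rightLeg_snd_assoc {W : C} (h : S ⟶ W) : rightLeg hP hr ≫ π₂ ≫ h = h := by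
  rw [← Category.assoc, rightLeg_snd]
  simp

end

lemma Centralise.exists_legs (h : Centralise r₁ r₂ s₁ s₂) (hP : IsPullback π₁ π₂ r₂ s₁)
    (hr : ReflexiveRelation r₁ r₂) (hs : ReflexiveRelation s₁ s₂) :
    ∃ θ : P ⟶ X, leftLeg hP hs ≫ θ = r₁ ∧ rightLeg hP hr ≫ θ = s₂ := by
  obtain ⟨θ, h₁, h₂⟩ := h.exists_connector hP
  exact ⟨θ, by simpa using h₁ (leftLeg hP hs) (by simp),
    by simpa using h₂ (rightLeg hP hr) (by simp)⟩

universe v' u'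

/-- Joint monicity of the images is assumed separately because preserving pullbacks does not imply
preserving products. -/
lemma Centralise.map {D : Type u'} [Category.{v'} D] (F : C ⥤ D)
    [PreservesLimitsOfShape WalkingCospan F]
    [JointlyMono₂ (F.map r₁) (F.map r₂)] [JointlyMono₂ (F.map s₁) (F.map s₂)]
    (hr : ReflexiveRelation r₁ r₂) (hs : ReflexiveRelation s₁ s₂)
    (h : Centralise r₁ r₂ s₁ s₂) :
    Centralise (F.map r₁) (F.map r₂) (F.map s₁) (F.map s₂) := by
  obtain ⟨P, π₁, π₂, hP, -⟩ := id h
  obtain ⟨θ, h₁, h₂⟩ := h.exists_legs hP hr hs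
  refine Centralise.of_legs (hP.map F) (i := F.map (leftLeg hP hs)) (j := F.map (rightLeg hP hr))
    ?_ ?_ ?_ ?_ (F.map θ) ?_ ?_
  all_goals simp only [← F.map_comp, h₁, h₂, leftLeg_fst, leftLeg_snd_assoc, rightLeg_fst_assoc,
    rightLeg_snd, hr.reflexivity₁, hs.reflexivity₂, Category.comp_id, F.map_id]

end Centralise

/-! ### Independence of Huq commutation from the chosen product. -/

section Huq

variable {C : Type u} [Category.{v} C] [HasZeroMorphisms C] {K L X : C} {k : K ⟶ X} {l : L ⟶ X}

lemma huqCommute_of_isLimit {P : C} {π₁ : P ⟶ K} {π₂ : P ⟶ L} (h : IsLimit (BinaryFan.mk π₁ π₂))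
    {i : K ⟶ P} {j : L ⟶ P} (i₁ : i ≫ π₁ = 𝟙 K) (i₂ : i ≫ π₂ = 0) (j₁ : j ≫ π₁ = 0)
    (j₂ : j ≫ π₂ = 𝟙 L) (φ : P ⟶ X) (hi : i ≫ φ = k) (hj : j ≫ φ = l) : HuqCommute k l := by
  refine ⟨P, π₁, π₂, h, φ, ?_, ?_⟩
  · rw [← hi]
    congr 1
    exact BinaryFan.IsLimit.hom_ext h ((h.fac _ ⟨WalkingPair.left⟩).trans i₁.symm)
      ((h.fac _ ⟨WalkingPair.right⟩).trans i₂.symm)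
  · rw [← hj]
    congr 1
    exact BinaryFan.IsLimit.hom_ext h ((h.fac _ ⟨WalkingPair.left⟩).trans j₁.symm)
      ((h.fac _ ⟨WalkingPair.right⟩).trans j₂.symm)

lemma HuqCommute.exists_sections (h : HuqCommute k l) :
    ∃ (P : C) (π₁ : P ⟶ K) (π₂ : P ⟶ L) (_ : IsLimit (BinaryFan.mk π₁ π₂)) (i : K ⟶ P)
      (j : L ⟶ P) (φ : P ⟶ X), i ≫ π₁ = 𝟙 K ∧ i ≫ π₂ = 0 ∧ j ≫ π₁ = 0 ∧ j ≫ π₂ = 𝟙 L ∧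
      i ≫ φ = k ∧ j ≫ φ = l := by
  obtain ⟨P, π₁, π₂, h, φ, h₁, h₂⟩ := h
  exact ⟨P, π₁, π₂, h, _, _, φ, h.fac _ ⟨WalkingPair.left⟩, h.fac _ ⟨WalkingPair.right⟩,
    h.fac _ ⟨WalkingPair.left⟩, h.fac _ ⟨WalkingPair.right⟩, h₁, h₂⟩

lemma huqCommute_of_prod [HasBinaryProduct K L] (φ : K ⨯ L ⟶ X)
    (hi : prod.lift (𝟙 K) 0 ≫ φ = k) (hj : prod.lift 0 (𝟙 L) ≫ φ = l) : HuqCommute k l :=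
  huqCommute_of_isLimit (prodIsProd K L) (prod.lift_fst _ _) (prod.lift_snd _ _)
    (prod.lift_fst _ _) (prod.lift_snd _ _) φ hi hj

lemma HuqCommute.exists_prod [HasBinaryProduct K L] (h : HuqCommute k l) :
    ∃ φ : K ⨯ L ⟶ X, prod.lift (𝟙 K) 0 ≫ φ = k ∧ prod.lift 0 (𝟙 L) ≫ φ = l := by
  obtain ⟨P, π₁, π₂, h, i, j, φ, i₁, i₂, j₁, j₂, hi, hj⟩ := h.exists_sections
  obtain ⟨m, hm₁, hm₂⟩ := BinaryFan.IsLimit.lift' h (prod.fst : K ⨯ L ⟶ K) prod.snd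
  change m ≫ π₁ = _ at hm₁
  change m ≫ π₂ = _ at hm₂
  refine ⟨m ≫ φ, ?_, ?_⟩
  · rw [← hi, ← Category.assoc]
    congr 1
    refine BinaryFan.IsLimit.hom_ext h ?_ ?_
    · change (_ ≫ m) ≫ π₁ = i ≫ π₁
      simp [hm₁, i₁]
    · change (_ ≫ m) ≫ π₂ = i ≫ π₂
      simp [hm₂, i₂]
  · rw [← hj, ← Category.assoc]
    congr 1
    refine BinaryFan.IsLimit.hom_ext h ?_ ?_
    · change (_ ≫ m) ≫ π₁ = j ≫ π₁
      simp [hm₁, j₁]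
    · change (_ ≫ m) ≫ π₂ = j ≫ π₂
      simp [hm₂, j₂]

end Huq

/-! ### Consequences of protomodularity on generalised elements. -/

section Protomodular

variable {C : Type u} [Category.{v} C] [SemiAbelian C] {B : C}

/-- Unique lifting of generalised elements lying over `e` makes the pullback of `f` along `e`
invertible, and `e^*` reflects isomorphisms. -/
lemma Pt.isIso_hom_of_fibre {E : C} (e : E ⟶ B) {X Y : Pt B} (f : X ⟶ Y)
    (inj : ∀ ⦃T : C⦄ (t t' : T ⟶ X.A) (c : T ⟶ E), t ≫ X.p = c ≫ e → t' ≫ X.p = c ≫ e →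
      t ≫ f.hom = t' ≫ f.hom → t = t')
    (surj : ∀ ⦃T : C⦄ (t : T ⟶ Y.A) (c : T ⟶ E), t ≫ Y.p = c ≫ e →
      ∃ t' : T ⟶ X.A, t' ≫ f.hom = t) : IsIso f.hom := by
  have : IsIso ((changeOfBase e).map f) := by
    suffices IsIso ((forget E).map ((changeOfBase e).map f)) from
      isIso_of_reflects_iso _ (forget E)
    change IsIso (pullbackMap e f)
    obtain ⟨t, ht⟩ := surj (pullback.fst Y.p e) (pullback.snd Y.p e) pullback.condition
    have htp : t ≫ X.p = pullback.snd Y.p e ≫ e := by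
      rw [← hom_p f, reassoc_of% ht, pullback.condition]
    refine ⟨pullback.lift t (pullback.snd Y.p e) htp, ?_, ?_⟩
    · apply pullback.hom_ext
      · exact inj _ _ (pullback.snd X.p e) (by simp [htp, reassoc_of% (pullbackMap_snd e f)])
          (by simp [pullback.condition]) (by simp [ht])
      · simp
    · apply pullback.hom_ext <;> simp [ht]
  have := SemiAbelian.protomodular e
  have : IsIso f := isIso_of_reflects_iso f (changeOfBase e)
  exact inferInstanceAs (IsIso ((forget B).map f))

/-- The equaliser of `a` and `b` contains the section, hence is a subpoint of `A`; it also contains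
the fibre over `e`, so it is everything. -/
lemma Pt.eq_of_fibre {E : C} (e : E ⟶ B) (A : Pt B) {Z : C} {a b : A.A ⟶ Z}
    (hs : A.s ≫ a = A.s ≫ b)
    (hA : ∀ ⦃T : C⦄ (t : T ⟶ A.A) (c : T ⟶ E), t ≫ A.p = c ≫ e → t ≫ a = t ≫ b) : a = b := by
  let M : Pt B := ⟨equalizer a b, equalizer.ι a b ≫ A.p, equalizer.lift A.s hs, by simp⟩
  let f : M ⟶ A := homMk (equalizer.ι a b) rfl (equalizer.lift_ι _ _)
  have : IsIso (equalizer.ι a b) := isIso_hom_of_fibre e f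
    (fun T t t' c _ _ h ↦ (cancel_mono (equalizer.ι a b)).1 h)
    (fun T t c h ↦ ⟨equalizer.lift t (hA t c h), equalizer.lift_ι _ _⟩)
  rw [← cancel_epi (equalizer.ι a b), equalizer.condition]

/-- Project the triples onto `S`, with section (y, z) ↦ (y, y, z). The fibre over the diagonal
`hs.r` consists of the triples (x, y, y), so the two legs already determine a morphism out of `P`.
-/
lemma connector_comp_eq {R S X P W : C} {r₁ r₂ : R ⟶ X} {s₁ s₂ : S ⟶ X} {π₁ : P ⟶ R} {π₂ : P ⟶ S}
    (hP : IsPullback π₁ π₂ r₂ s₁) (hr : ReflexiveRelation r₁ r₂) (hs : ReflexiveRelation s₁ s₂)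
    {θ : P ⟶ X} (h₁ : leftLeg hP hs ≫ θ = r₁) (h₂ : rightLeg hP hr ≫ θ = s₂) (q : X ⟶ W)
    (hqr : r₁ ≫ q = r₂ ≫ q) (hqs : s₁ ≫ q = s₂ ≫ q) : θ ≫ q = π₁ ≫ r₂ ≫ q := by
  refine Pt.eq_of_fibre hs.r ⟨P, π₂, rightLeg hP hr, by simp⟩ ?_ (fun T t c h ↦ ?_)
  · simp [reassoc_of% h₂, hqs]
  · have : t = (t ≫ π₁) ≫ leftLeg hP hs := by
      refine hP.hom_ext (by simp) ?_
      change t ≫ π₂ = _ at h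
      have hc : c = t ≫ π₂ ≫ s₁ := by rw [reassoc_of% h, hs.reflexivity₁, Category.comp_id]
      rw [h, hc, ← hP.w]
      simp
    rw [this]
    simp [reassoc_of% h₁, hqr]

variable [HasZeroMorphisms C]

open ZeroObject in
lemma Pt.isIso_hom_of_kernel {X Y : Pt B} (f : X ⟶ Y)
    (inj : ∀ ⦃T : C⦄ (t t' : T ⟶ X.A), t ≫ X.p = 0 → t' ≫ X.p = 0 →
      t ≫ f.hom = t' ≫ f.hom → t = t')
    (surj : ∀ ⦃T : C⦄ (t : T ⟶ Y.A), t ≫ Y.p = 0 → ∃ t' : T ⟶ X.A, t' ≫ f.hom = t) :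
    IsIso f.hom :=
  isIso_hom_of_fibre (0 : (0 : C) ⟶ B) f
    (fun T t t' c h h' ↦ inj t t' (by simpa using h) (by simpa using h'))
    (fun T t c h ↦ surj t (by simpa using h))

-- The inclusion of `L` is a section of the second projection, whose fibre over 0 is `K`.
open ZeroObject in
lemma prod_hom_ext_of_sections {K L Z : C} {a b : K ⨯ L ⟶ Z}
    (hK : prod.lift (𝟙 K) 0 ≫ a = prod.lift (𝟙 K) 0 ≫ b)
    (hL : prod.lift 0 (𝟙 L) ≫ a = prod.lift 0 (𝟙 L) ≫ b) : a = b := by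
  refine Pt.eq_of_fibre (0 : (0 : C) ⟶ L) ⟨K ⨯ L, prod.snd, prod.lift 0 (𝟙 L), by simp⟩ hL
    (fun T t c h ↦ ?_)
  have : t = (t ≫ prod.fst) ≫ prod.lift (𝟙 K) 0 := by
    apply Limits.prod.hom_ext
    · simp
    · simpa using h
  rw [this, Category.assoc, Category.assoc, Category.assoc, Category.assoc, hK]

end Protomodular

/-! ### Joint monicity and equivalence relations under the functors involved. -/

section Relations

universe v' u'

variable {C : Type u} [Category.{v} C]

lemma jointlyMono₂_of_map {D : Type u'} [Category.{v'} D] (F : C ⥤ D) [F.Faithful] {R X : C}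
    {r₁ r₂ : R ⟶ X} (h : JointlyMono₂ (F.map r₁) (F.map r₂)) : JointlyMono₂ r₁ r₂ where
  right_cancellation Y f g h₁ h₂ := F.map_injective
    (h.right_cancellation _ _ (by simp only [← F.map_comp, h₁]) (by simp only [← F.map_comp, h₂]))

lemma isEquivalenceRelation_map {D : Type u'} [Category.{v'} D] (F : C ⥤ D)
    [PreservesLimitsOfShape WalkingCospan F] {R X : C} {r₁ r₂ : R ⟶ X}
    [JointlyMono₂ (F.map r₁) (F.map r₂)] (h : IsEquivalenceRelation r₁ r₂) :
    IsEquivalenceRelation (F.map r₁) (F.map r₂) := by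
  obtain ⟨⟨h⟩⟩ := h
  exact ⟨⟨{ h.toReflexiveRelation.map F, h.toSymmetricRelation.map F,
    h.toTransitiveRelation.map F with }⟩⟩

lemma isEquivalenceRelation_of_isKernelPair [HasPullbacks C] {R X Y : C} {f : X ⟶ Y}
    {r₁ r₂ : R ⟶ X} (h : IsKernelPair f r₁ r₂) : IsEquivalenceRelation r₁ r₂ :=
  ⟨⟨h.equivalenceRelation f r₁ r₂ (pullback.isLimit r₂ r₁)⟩⟩

lemma jointlyMono₂_left {B : C} {R X : Over B} {r₁ r₂ : R ⟶ X} (h : JointlyMono₂ r₁ r₂) :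
    JointlyMono₂ r₁.left r₂.left where
  right_cancellation Y f g h₁ h₂ := by
    let f' : Over.mk (f ≫ R.hom) ⟶ R := Over.homMk f rfl
    let g' : Over.mk (f ≫ R.hom) ⟶ R := Over.homMk g (by
      change g ≫ R.hom = f ≫ R.hom
      rw [← Over.w r₁, ← reassoc_of% h₁])
    exact congr(Over.Hom.left $(h.right_cancellation f' g' (Over.OverMorphism.ext h₁)
      (Over.OverMorphism.ext h₂)))

instance {B : C} : (Pt.forget B).Faithful where
  map_injective h := Pt.hom_ext h

lemma jointlyMono₂_pullback [HasPullbacks C] {E B : C} (p : E ⟶ B) {R X : C} {x : X ⟶ B}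
    {y : R ⟶ B} {r₁ r₂ : R ⟶ X} (h : JointlyMono₂ r₁ r₂) {q₁ q₂ : pullback y p ⟶ pullback x p}
    (h₁ : q₁ ≫ pullback.fst x p = pullback.fst y p ≫ r₁)
    (h₁' : q₁ ≫ pullback.snd x p = pullback.snd y p)
    (h₂ : q₂ ≫ pullback.fst x p = pullback.fst y p ≫ r₂) : JointlyMono₂ q₁ q₂ where
  right_cancellation Y f g hf hg := by
    apply pullback.hom_ext
    · apply h.right_cancellation
      · rw [Category.assoc, ← h₁, reassoc_of% hf, h₁, Category.assoc]
      · rw [Category.assoc, ← h₂, reassoc_of% hg, h₂, Category.assoc]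
    · rw [← h₁', reassoc_of% hf]

/-- The kernel pair in `C` of the pairing `d` carries a structure of point over `B`, so joint
monicity in points already identifies its two projections. -/
lemma jointlyMono₂_hom [HasFiniteLimits C] {B : C} {R X : Pt B} {r₁ r₂ : R ⟶ X}
    (h : JointlyMono₂ r₁ r₂) : JointlyMono₂ r₁.hom r₂.hom where
  right_cancellation Y f g h₁ h₂ := by
    let d := prod.lift r₁.hom r₂.hom
    have hd : pullback.fst d d ≫ r₁.hom = pullback.snd d d ≫ r₁.hom := by
      simpa [d] using congr($(pullback.condition (f := d) (g := d)) ≫ prod.fst)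
    have hd' : pullback.fst d d ≫ r₂.hom = pullback.snd d d ≫ r₂.hom := by
      simpa [d] using congr($(pullback.condition (f := d) (g := d)) ≫ prod.snd)
    let W : Pt B := ⟨pullback d d, pullback.fst d d ≫ R.p, pullback.lift R.s R.s rfl, by simp⟩
    let a : W ⟶ R := Pt.homMk (pullback.fst d d) rfl (pullback.lift_fst _ _ _)
    let b : W ⟶ R := Pt.homMk (pullback.snd d d)
      (by
        change _ = pullback.fst d d ≫ R.p
        rw [← Pt.hom_p r₁, reassoc_of% hd])
      (pullback.lift_snd _ _ _)
    have hab : pullback.fst d d = pullback.snd d d :=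
      congr(Pt.Hom.hom $(h.right_cancellation a b (Pt.hom_ext hd) (Pt.hom_ext hd')))
    have hfg : f ≫ d = g ≫ d := by
      apply Limits.prod.hom_ext <;> simp [d, h₁, h₂]
    simpa using congr(pullback.lift f g hfg ≫ $hab)

lemma jointlyMono₂_changeOfBase [HasFiniteLimits C] {E B : C} (p : E ⟶ B) {R X : Pt B}
    {r₁ r₂ : R ⟶ X} (h : JointlyMono₂ r₁ r₂) :
    JointlyMono₂ ((Pt.changeOfBase p).map r₁) ((Pt.changeOfBase p).map r₂) :=
  jointlyMono₂_of_map (Pt.forget E) (jointlyMono₂_pullback p (jointlyMono₂_hom h)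
    (Pt.pullbackMap_fst p r₁) (Pt.pullbackMap_snd p r₁) (Pt.pullbackMap_fst p r₂))

end Relations

/-! ### Lifting connectors to slices and to points. -/

section Lifting

variable {C : Type u} [Category.{v} C] [SemiAbelian C] {B : C}

lemma centralise_of_left {R S X : Over B} {r₁ r₂ : R ⟶ X} {s₁ s₂ : S ⟶ X}
    (hr : ReflexiveRelation r₁ r₂) (hs : ReflexiveRelation s₁ s₂)
    (h : Centralise r₁.left r₂.left s₁.left s₂.left) : Centralise r₁ r₂ s₁ s₂ := by
  have := hr.toJointlyMono₂
  have := hs.toJointlyMono₂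
  have : JointlyMono₂ ((Over.forget B).map r₁) ((Over.forget B).map r₂) :=
    jointlyMono₂_left hr.toJointlyMono₂
  have : JointlyMono₂ ((Over.forget B).map s₁) ((Over.forget B).map s₂) :=
    jointlyMono₂_left hs.toJointlyMono₂
  have hP := IsPullback.of_hasPullback r₂ s₁
  have hP' := hP.map (Over.forget B)
  obtain ⟨θ, h₁, h₂⟩ := h.exists_legs hP' (hr.map (Over.forget B)) (hs.map (Over.forget B))
  have hq := connector_comp_eq hP' (hr.map (Over.forget B)) (hs.map (Over.forget B)) h₁ h₂ X.hom
    ((Over.w r₁).trans (Over.w r₂).symm) ((Over.w s₁).trans (Over.w s₂).symm)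
  have hl : (leftLeg hP hs).left = leftLeg hP' (hs.map (Over.forget B)) := hP'.hom_ext
    ((congr(Over.Hom.left $(leftLeg_fst hP hs))).trans (leftLeg_fst hP' (hs.map (Over.forget B))).symm)
    ((congr(Over.Hom.left $(leftLeg_snd hP hs))).trans (leftLeg_snd hP' (hs.map (Over.forget B))).symm)
  have hr' : (rightLeg hP hr).left = rightLeg hP' (hr.map (Over.forget B)) := hP'.hom_ext
    ((congr(Over.Hom.left $(rightLeg_fst hP hr))).trans (rightLeg_fst hP' (hr.map (Over.forget B))).symm)
    ((congr(Over.Hom.left $(rightLeg_snd hP hr))).trans (rightLeg_snd hP' (hr.map (Over.forget B))).symm)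
  refine Centralise.of_legs hP (leftLeg_fst hP hs) (by simp) (by simp) (rightLeg_snd hP hr)
    (Over.homMk θ (hq.trans ?_)) (Over.OverMorphism.ext ?_) (Over.OverMorphism.ext ?_)
  · change (pullback.fst r₂ s₁).left ≫ r₂.left ≫ X.hom = _
    rw [Over.w, Over.w]
  · exact congr($hl ≫ θ).trans h₁
  · exact congr($hr' ≫ θ).trans h₂

/-- A connector in `C` lies over `B` by `connector_comp_eq`; it preserves sections because the
section of the triples factors through the left leg. -/
lemma centralise_of_hom {R S X : Pt B} {r₁ r₂ : R ⟶ X} {s₁ s₂ : S ⟶ X}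
    (hr : ReflexiveRelation r₁ r₂) (hs : ReflexiveRelation s₁ s₂)
    (h : Centralise r₁.hom r₂.hom s₁.hom s₂.hom) : Centralise r₁ r₂ s₁ s₂ := by
  have := hr.toJointlyMono₂
  have := hs.toJointlyMono₂
  have : JointlyMono₂ ((Pt.forget B).map r₁) ((Pt.forget B).map r₂) :=
    jointlyMono₂_hom hr.toJointlyMono₂
  have : JointlyMono₂ ((Pt.forget B).map s₁) ((Pt.forget B).map s₂) :=
    jointlyMono₂_hom hs.toJointlyMono₂
  have hP := IsPullback.of_hasPullback r₂ s₁
  have hP' := hP.map (Pt.forget B)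
  obtain ⟨θ, h₁, h₂⟩ := h.exists_legs hP' (hr.map (Pt.forget B)) (hs.map (Pt.forget B))
  have hq := connector_comp_eq hP' (hr.map (Pt.forget B)) (hs.map (Pt.forget B)) h₁ h₂ X.p
    ((Pt.hom_p r₁).trans (Pt.hom_p r₂).symm) ((Pt.hom_p s₁).trans (Pt.hom_p s₂).symm)
  have hl : (leftLeg hP hs).hom = leftLeg hP' (hs.map (Pt.forget B)) := hP'.hom_ext
    ((congr(Pt.Hom.hom $(leftLeg_fst hP hs))).trans (leftLeg_fst hP' (hs.map (Pt.forget B))).symm)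
    ((congr(Pt.Hom.hom $(leftLeg_snd hP hs))).trans (leftLeg_snd hP' (hs.map (Pt.forget B))).symm)
  have hr' : (rightLeg hP hr).hom = rightLeg hP' (hr.map (Pt.forget B)) := hP'.hom_ext
    ((congr(Pt.Hom.hom $(rightLeg_fst hP hr))).trans (rightLeg_fst hP' (hr.map (Pt.forget B))).symm)
    ((congr(Pt.Hom.hom $(rightLeg_snd hP hr))).trans (rightLeg_snd hP' (hr.map (Pt.forget B))).symm)
  have hlθ : (leftLeg hP hs).hom ≫ θ = r₁.hom := congr($hl ≫ θ).trans h₁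
  refine Centralise.of_legs hP (leftLeg_fst hP hs) (by simp) (by simp) (rightLeg_snd hP hr)
    (Pt.homMk θ (hq.trans ?_) ?_) (Pt.hom_ext hlθ) (Pt.hom_ext ?_)
  · change (pullback.fst r₂ s₁).hom ≫ r₂.hom ≫ X.p = _
    rw [Pt.hom_p, Pt.hom_p]
  · calc (pullback r₂ s₁).s ≫ θ
      _ = (R.s ≫ (leftLeg hP hs).hom) ≫ θ := congr($((Pt.s_hom (leftLeg hP hs)).symm) ≫ θ)
      _ = R.s ≫ (leftLeg hP hs).hom ≫ θ := Category.assoc _ _ _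
      _ = X.s := by rw [hlθ, Pt.s_hom]
  · exact congr($hr' ≫ θ).trans h₂

end Lifting

/-! ### From (SH) to the basic fibration, and from there to (C̄). -/

section BasicFibration

variable (C : Type u) [Category.{v} C] [SemiAbelian C]

lemma conditionCBar_of_basicReflectsCentralisation (h : BasicReflectsCentralisation C) :
    ConditionCBar C := by
  intro E B p R S X r₁ r₂ s₁ s₂ hr hs hc
  obtain ⟨⟨er⟩⟩ := id hr
  obtain ⟨⟨es⟩⟩ := id hs
  have jr := er.toJointlyMono₂
  have js := es.toJointlyMono₂
  have := jointlyMono₂_changeOfBase p jr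
  have := jointlyMono₂_changeOfBase p js
  have : JointlyMono₂ ((Pt.toOver B).map r₁) ((Pt.toOver B).map r₂) :=
    jointlyMono₂_of_map (Over.forget B) (jointlyMono₂_hom jr)
  have : JointlyMono₂ ((Pt.toOver B).map s₁) ((Pt.toOver B).map s₂) :=
    jointlyMono₂_of_map (Over.forget B) (jointlyMono₂_hom js)
  have : JointlyMono₂ ((Pt.toOver E).map ((Pt.changeOfBase p).map r₁))
      ((Pt.toOver E).map ((Pt.changeOfBase p).map r₂)) :=
    jointlyMono₂_of_map (Over.forget E) (jointlyMono₂_hom (jointlyMono₂_changeOfBase p jr))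
  have : JointlyMono₂ ((Pt.toOver E).map ((Pt.changeOfBase p).map s₁))
      ((Pt.toOver E).map ((Pt.changeOfBase p).map s₂)) :=
    jointlyMono₂_of_map (Over.forget E) (jointlyMono₂_hom (jointlyMono₂_changeOfBase p js))
  have hc' := hc.map (Pt.toOver E) (er.toReflexiveRelation.map _) (es.toReflexiveRelation.map _)
  have hB := h p ((Pt.toOver B).map r₁) ((Pt.toOver B).map r₂) ((Pt.toOver B).map s₁)
    ((Pt.toOver B).map s₂) (isEquivalenceRelation_map _ hr) (isEquivalenceRelation_map _ hs) hc'
  have : JointlyMono₂ ((Over.forget B).map ((Pt.toOver B).map r₁))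
    ((Over.forget B).map ((Pt.toOver B).map r₂)) := jointlyMono₂_hom jr
  have : JointlyMono₂ ((Over.forget B).map ((Pt.toOver B).map s₁))
    ((Over.forget B).map ((Pt.toOver B).map s₂)) := jointlyMono₂_hom js
  exact centralise_of_hom er.toReflexiveRelation es.toReflexiveRelation
    (hB.map (Over.forget B) (er.toReflexiveRelation.map _) (es.toReflexiveRelation.map _))

lemma basicReflectsCentralisation_of_smithIsHuq [HasZeroMorphisms C] (h : SmithIsHuq C) :
    BasicReflectsCentralisation C := by
  intro E B p R S X r₁ r₂ s₁ s₂ hr hs hc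
  obtain ⟨⟨er⟩⟩ := id hr
  obtain ⟨⟨es⟩⟩ := id hs
  have : JointlyMono₂ ((Over.forget B).map r₁) ((Over.forget B).map r₂) :=
    jointlyMono₂_left er.toJointlyMono₂
  have : JointlyMono₂ ((Over.forget B).map s₁) ((Over.forget B).map s₂) :=
    jointlyMono₂_left es.toJointlyMono₂
  refine centralise_of_left er.toReflexiveRelation es.toReflexiveRelation
    (h r₁.left r₂.left s₁.left s₂.left (isEquivalenceRelation_map (Over.forget B) hr)
      (isEquivalenceRelation_map (Over.forget B) hs) ?_)
  obtain ⟨P, π₁, π₂, hP, θ, h₁, h₂⟩ := hc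
  let K := kernel r₁.left
  let L := kernel s₁.left
  -- Reversing (0, k) to (k, 0) makes it composable with (0, l); the Huq morphism will be the
  -- connector at (k, 0, l).
  let κ : K ⟶ R.left := kernel.ι r₁.left ≫ er.s.left
  let l : L ⟶ S.left := kernel.ι s₁.left
  have κ₁ : κ ≫ r₁.left = normalisation r₁.left r₂.left := by
    simp only [κ, normalisation, Category.assoc, ← Over.comp_left, er.symmetry₁]
  have κ₂ : κ ≫ r₂.left = 0 := by
    simp only [κ, Category.assoc, ← Over.comp_left, er.symmetry₂]
    exact kernel.condition _
  have l₁ : l ≫ s₁.left = 0 := kernel.condition _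
  have κB : κ ≫ R.hom = 0 := by rw [← Over.w r₂, reassoc_of% κ₂, zero_comp]
  have lB : l ≫ S.hom = 0 := by rw [← Over.w s₁, reassoc_of% l₁, zero_comp]
  -- Both pairs lie over 0 in `B`, so the zero map to `E` lifts them to the pullbacks along any `p`.
  let a : Over.mk (0 : K ⨯ L ⟶ E) ⟶ (Over.pullback p).obj R :=
    Over.homMk (pullback.lift (prod.fst ≫ κ) 0 (by simp [κB])) (pullback.lift_snd _ _ _)
  let b : Over.mk (0 : K ⨯ L ⟶ E) ⟶ (Over.pullback p).obj S :=
    Over.homMk (pullback.lift (prod.snd ≫ l) 0 (by simp [lB])) (pullback.lift_snd _ _ _)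
  have hR (r : R ⟶ X) : (a ≫ (Over.pullback p).map r).left ≫ pullback.fst X.hom p =
      prod.fst ≫ κ ≫ r.left := by
    change (pullback.lift (prod.fst ≫ κ) 0 _ ≫ pullback.lift _ _ _) ≫ _ = _
    simp
  have hS (s : S ⟶ X) : (b ≫ (Over.pullback p).map s).left ≫ pullback.fst X.hom p =
      prod.snd ≫ l ≫ s.left := by
    change (pullback.lift (prod.snd ≫ l) 0 _ ≫ pullback.lift _ _ _) ≫ _ = _
    simp
  have hR' {T : Over E} (g : T ⟶ Over.mk (0 : K ⨯ L ⟶ E)) (r : R ⟶ X) :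
      (g ≫ a ≫ (Over.pullback p).map r).left ≫ pullback.fst X.hom p =
        g.left ≫ prod.fst ≫ κ ≫ r.left := by
    rw [Over.comp_left, Category.assoc, hR]
  have hS' {T : Over E} (g : T ⟶ Over.mk (0 : K ⨯ L ⟶ E)) (s : S ⟶ X) :
      (g ≫ b ≫ (Over.pullback p).map s).left ≫ pullback.fst X.hom p =
        g.left ≫ prod.snd ≫ l ≫ s.left := by
    rw [Over.comp_left, Category.assoc, hS]
  have ext {T : Over E} {c d : T ⟶ (Over.pullback p).obj X}
      (hcd : c.left ≫ pullback.fst X.hom p = d.left ≫ pullback.fst X.hom p) : c = d :=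
    Over.OverMorphism.ext (pullback.hom_ext hcd ((Over.w c).trans (Over.w d).symm))
  have w : a ≫ (Over.pullback p).map r₂ = b ≫ (Over.pullback p).map s₁ :=
    ext (by rw [hR, hS, κ₂, l₁, comp_zero, comp_zero])
  let m := hP.lift a b w
  have m₁ : m ≫ π₁ = a := hP.lift_fst _ _ _
  have m₂ : m ≫ π₂ = b := hP.lift_snd _ _ _
  let i : Over.mk (0 : K ⟶ E) ⟶ Over.mk (0 : K ⨯ L ⟶ E) :=
    Over.homMk (prod.lift (𝟙 K) 0) comp_zero
  let j : Over.mk (0 : L ⟶ E) ⟶ Over.mk (0 : K ⨯ L ⟶ E) :=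
    Over.homMk (prod.lift 0 (𝟙 L)) comp_zero
  refine huqCommute_of_prod (m.left ≫ θ.left ≫ pullback.fst X.hom p) ?_ ?_
  · have e := h₁ (i ≫ m) (by
      rw [Category.assoc, Category.assoc, reassoc_of% m₂]
      apply ext
      rw [reassoc_of% m₂, hS', hS']
      simp [i])
    rw [Category.assoc, Category.assoc, reassoc_of% m₁] at e
    have e' := congr(Over.Hom.left $e ≫ pullback.fst X.hom p)
    rw [hR', κ₁] at e'
    simp only [Over.comp_left, Category.assoc] at e'
    refine e'.trans ?_
    simp [i]
  · have e := h₂ (j ≫ m) (by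
      rw [Category.assoc, Category.assoc, reassoc_of% m₁]
      apply ext
      rw [reassoc_of% m₁, hR', hR']
      simp [j])
    rw [Category.assoc, Category.assoc, reassoc_of% m₂] at e
    have e' := congr(Over.Hom.left $e ≫ pullback.fst X.hom p)
    rw [hS'] at e'
    simp only [Over.comp_left, Category.assoc] at e'
    refine e'.trans ?_
    simp [j]
    rfl

end BasicFibration

/-! ### Equivalence relations as normal subobjects in points. -/

section RelationPoints

variable {C : Type u} [Category.{v} C] {R X : C} {r₁ r₂ : R ⟶ X}

/-- A reflexive relation, viewed as a point over its base object by the first projection. -/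
abbrev relationPt (hr : ReflexiveRelation r₁ r₂) : Pt X where
  A := R
  p := r₁
  s := hr.r
  s_p := hr.reflexivity₁

/-- The product `X ⨯ Y`, viewed as a point over `X` with section the graph of `f`. -/
noncomputable abbrev graphPt [HasBinaryProducts C] {Y : C} (f : X ⟶ Y) : Pt X where
  A := X ⨯ Y
  p := prod.fst
  s := prod.lift (𝟙 X) f
  s_p := prod.lift_fst _ _

/-- The inclusion of a relation on `X` into `X ⨯ X`, as a morphism of points. -/
noncomputable def relationInclusion [HasBinaryProducts C] (hr : ReflexiveRelation r₁ r₂) :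
    relationPt hr ⟶ graphPt (𝟙 X) :=
  Pt.homMk (prod.lift r₁ r₂) (prod.lift_fst _ _)
    (Limits.prod.hom_ext (by simp) (by simp))

/-- The relation is the kernel of (x, x') ↦ (x, f x'): since the zero map sends (x, x') to (x, f x),
the kernel is cut out by f x = f x'. -/
lemma nonempty_normalMono_relationInclusion [HasBinaryProducts C] {Y : C} {f : X ⟶ Y}
    (hf : IsKernelPair f r₁ r₂) (hr : ReflexiveRelation r₁ r₂) :
    Nonempty (NormalMono (relationInclusion hr)) := by
  let q : graphPt (𝟙 X) ⟶ graphPt f := Pt.homMk (prod.lift prod.fst (prod.snd ≫ f))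
    (prod.lift_fst _ _) (by apply Limits.prod.hom_ext <;> simp)
  have w : relationInclusion hr ≫ q = 0 := by
    apply Pt.hom_ext
    change prod.lift r₁ r₂ ≫ prod.lift prod.fst (prod.snd ≫ f) = r₁ ≫ prod.lift (𝟙 X) f
    apply Limits.prod.hom_ext <;> simp [hf.w]
  have aux {W : Pt X} (h : W ⟶ graphPt (𝟙 X)) (hh : h ≫ q = 0) :
      W.p ≫ f = (h.hom ≫ prod.snd) ≫ f := by
    have e : (h.hom ≫ prod.lift prod.fst (prod.snd ≫ f)) ≫ prod.snd =
      (W.p ≫ prod.lift (𝟙 X) f) ≫ prod.snd := congr(Pt.Hom.hom $hh ≫ prod.snd)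
    simpa using e.symm
  have hp {W : Pt X} (h : W ⟶ graphPt (𝟙 X)) : h.hom ≫ prod.fst = W.p := Pt.hom_p h
  have hs {W : Pt X} (h : W ⟶ graphPt (𝟙 X)) : W.s ≫ h.hom = prod.lift (𝟙 X) (𝟙 X) := Pt.s_hom h
  refine ⟨⟨_, q, w, KernelFork.IsLimit.ofι _ _
    (fun h hh ↦ Pt.homMk (hf.lift _ _ (aux h hh)) (hf.lift_fst _ _ _) (hf.hom_ext ?_ ?_))
    (fun h hh ↦ Pt.hom_ext (Limits.prod.hom_ext ?_ ?_))
    (fun h hh m hm ↦ Pt.hom_ext (hf.hom_ext ?_ ?_))⟩⟩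
  · simp
  · simp [reassoc_of% (hs h)]
  · change (hf.lift _ _ _ ≫ prod.lift r₁ r₂) ≫ prod.fst = h.hom ≫ prod.fst
    simp [hp]
  · change (hf.lift _ _ _ ≫ prod.lift r₁ r₂) ≫ prod.snd = h.hom ≫ prod.snd
    simp
  · exact (Pt.hom_p m).trans (hf.lift_fst _ _ _).symm
  · have e : (m.hom ≫ prod.lift r₁ r₂) ≫ prod.snd = h.hom ≫ prod.snd :=
      congr(Pt.Hom.hom $hm ≫ prod.snd)
    refine Eq.trans ?_ (hf.lift_snd _ _ _).symm
    simpa using e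

end RelationPoints

/-! ### Huq commutation in points, expressed by pullbacks in the base category. -/

section HuqPoints

variable {C : Type u} [Category.{v} C] {B : C} {K L X : Pt B} {k : K ⟶ X} {l : L ⟶ X}

lemma Pt.huqCommute_of_isPullback {P : C} {π₁ : P ⟶ K.A} {π₂ : P ⟶ L.A}
    (hP : IsPullback π₁ π₂ K.p L.p) {i : K.A ⟶ P} {j : L.A ⟶ P} (i₁ : i ≫ π₁ = 𝟙 K.A)
    (i₂ : i ≫ π₂ = K.p ≫ L.s) (j₁ : j ≫ π₁ = L.p ≫ K.s) (j₂ : j ≫ π₂ = 𝟙 L.A) (φ : P ⟶ X.A)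
    (hφ : φ ≫ X.p = π₁ ≫ K.p) (hi : i ≫ φ = k.hom) (hj : j ≫ φ = l.hom) : HuqCommute k l := by
  let P' : Pt B := ⟨P, π₁ ≫ K.p, hP.lift K.s L.s (by simp), by simp⟩
  let a : P' ⟶ K := homMk π₁ rfl (hP.lift_fst _ _ _)
  let b : P' ⟶ L := homMk π₂ hP.w.symm (hP.lift_snd _ _ _)
  have hs : hP.lift K.s L.s (by simp) = K.s ≫ i :=
    hP.hom_ext (by simp [i₁]) (by simp [i₂])
  have hs' : hP.lift K.s L.s (by simp) = L.s ≫ j :=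
    hP.hom_ext (by simp [j₁]) (by simp [j₂])
  let lift {W : Pt B} (x : W ⟶ K) (y : W ⟶ L) : W ⟶ P' :=
    homMk (hP.lift x.hom y.hom (by simp)) ((hP.lift_fst_assoc _ _ _ _).trans (hom_p x))
      (hP.hom_ext (by simp [P']) (by simp [P']))
  have hL : IsLimit (BinaryFan.mk a b) := BinaryFan.isLimitMk (fun s ↦ lift s.fst s.snd)
    (fun s ↦ hom_ext (hP.lift_fst _ _ _)) (fun s ↦ hom_ext (hP.lift_snd _ _ _))
    (fun s m h₁ h₂ ↦ hom_ext (hP.hom_ext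
      ((congr(Hom.hom $h₁)).trans (hP.lift_fst _ _ _).symm)
      ((congr(Hom.hom $h₂)).trans (hP.lift_snd _ _ _).symm)))
  refine huqCommute_of_isLimit hL
    (i := homMk i (by
      change i ≫ π₁ ≫ K.p = K.p
      rw [reassoc_of% i₁]) hs.symm)
    (j := homMk j (by
      change j ≫ π₁ ≫ K.p = L.p
      rw [hP.w, reassoc_of% j₂]) hs'.symm)
    (hom_ext i₁) (hom_ext i₂) (hom_ext j₁) (hom_ext j₂) (homMk φ hφ ?_) (hom_ext hi) (hom_ext hj)
  change hP.lift K.s L.s (by simp) ≫ φ = X.s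
  rw [hs, Category.assoc, hi, s_hom]

lemma Pt.exists_of_huqCommute [HasPullbacks C] (h : HuqCommute k l) :
    ∃ (P : C) (π₁ : P ⟶ K.A) (π₂ : P ⟶ L.A) (_ : IsPullback π₁ π₂ K.p L.p)
      (i : K.A ⟶ P) (j : L.A ⟶ P) (φ : P ⟶ X.A), i ≫ π₁ = 𝟙 K.A ∧ i ≫ π₂ = K.p ≫ L.s ∧
      j ≫ π₁ = L.p ≫ K.s ∧ j ≫ π₂ = 𝟙 L.A ∧ i ≫ φ = k.hom ∧ j ≫ φ = l.hom := by
  obtain ⟨P, π₁, π₂, hP, i, j, φ, i₁, i₂, j₁, j₂, hi, hj⟩ := h.exists_sections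
  exact ⟨P.A, π₁.hom, π₂.hom, isPullback_of_isLimit_binaryFan hP, i.hom, j.hom, φ.hom,
    congr(Hom.hom $i₁), congr(Hom.hom $i₂), congr(Hom.hom $j₁), congr(Hom.hom $j₂),
    congr(Hom.hom $hi), congr(Hom.hom $hj)⟩

end HuqPoints

/-! ### Equivalence of (SH) and (C). -/

section ConditionC

variable (C : Type u) [Category.{v} C] [HasZeroMorphisms C] [SemiAbelian C]

lemma conditionC_of_smithIsHuq (h : SmithIsHuq C) : ConditionC C := by
  rintro E B p K L X k l ⟨⟨Y, f, wf, hf⟩⟩ ⟨⟨Z, g, wg, hg⟩⟩ hc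
  replace hf := Pt.isPullback_of_isKernel hf
  replace hg := Pt.isPullback_of_isKernel hg
  have kf := IsKernelPair.of_hasPullback f.hom
  have kg := IsKernelPair.of_hasPullback g.hom
  obtain ⟨⟨er⟩⟩ := isEquivalenceRelation_of_isKernelPair kf
  obtain ⟨⟨es⟩⟩ := isEquivalenceRelation_of_isKernelPair kg
  have hcent : Centralise (pullback.fst f.hom f.hom) (pullback.snd f.hom f.hom)
      (pullback.fst g.hom g.hom) (pullback.snd g.hom g.hom) := by
    refine h _ _ _ _ ⟨⟨er⟩⟩ ⟨⟨es⟩⟩ ?_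
    obtain ⟨P, π₁, π₂, hP, i, j, φ, i₁, i₂, j₁, j₂, hi, hj⟩ : ∃ (P : C)
        (π₁ : P ⟶ pullback K.p p) (π₂ : P ⟶ pullback L.p p)
        (_ : IsPullback π₁ π₂ (pullback.snd K.p p) (pullback.snd L.p p))
        (i : pullback K.p p ⟶ P) (j : pullback L.p p ⟶ P) (φ : P ⟶ pullback X.p p),
        i ≫ π₁ = 𝟙 _ ∧ i ≫ π₂ = pullback.snd K.p p ≫ pullback.lift (p ≫ L.s) (𝟙 E) (by simp) ∧
        j ≫ π₁ = pullback.snd L.p p ≫ pullback.lift (p ≫ K.s) (𝟙 E) (by simp) ∧ j ≫ π₂ = 𝟙 _ ∧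
        i ≫ φ = Pt.pullbackMap p k ∧ j ≫ φ = Pt.pullbackMap p l := Pt.exists_of_huqCommute hc
    set n := normalisation (pullback.fst f.hom f.hom) (pullback.snd f.hom f.hom)
    set m := normalisation (pullback.fst g.hom g.hom) (pullback.snd g.hom g.hom)
    have hn : n ≫ f.hom = 0 ≫ Y.s := by simp [n, normalisation, ← pullback.condition]
    have hm : m ≫ g.hom = 0 ≫ Z.s := by simp [m, normalisation, ← pullback.condition]
    -- The normalisation of the kernel pair of `f.hom` is killed by `f.hom`, so it factors through
    -- `K` over 0 and then through the pullback along `p`.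
    let a : _ ⟶ pullback K.p p := pullback.lift (hf.lift n 0 hn) 0 (by simp)
    let b : _ ⟶ pullback L.p p := pullback.lift (hg.lift m 0 hm) 0 (by simp)
    have ha : a ≫ pullback.fst K.p p ≫ k.hom = n := by simp [a]
    have hb : b ≫ pullback.fst L.p p ≫ l.hom = m := by simp [b]
    have ha' : a ≫ pullback.snd K.p p = 0 := by simp [a]
    have hb' : b ≫ pullback.snd L.p p = 0 := by simp [b]
    let c := hP.lift (prod.fst ≫ a) (prod.snd ≫ b) (by simp [ha', hb'])
    have hci : prod.lift (𝟙 _) 0 ≫ c = a ≫ i := by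
      apply hP.hom_ext
      · simp [c, i₁]
      · simp [c, i₂, reassoc_of% ha']
    have hcj : prod.lift 0 (𝟙 _) ≫ c = b ≫ j := by
      apply hP.hom_ext
      · simp [c, j₁, reassoc_of% hb']
      · simp [c, j₂]
    refine huqCommute_of_prod (c ≫ φ ≫ pullback.fst X.p p) ?_ ?_
    · rw [reassoc_of% hci, reassoc_of% hi, Pt.pullbackMap_fst, ha]
    · rw [reassoc_of% hcj, reassoc_of% hj, Pt.pullbackMap_fst, hb]
  have hD := IsPullback.of_hasPullback (pullback.snd f.hom f.hom) (pullback.fst g.hom g.hom)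
  obtain ⟨θ, h₁, h₂⟩ := hcent.exists_connector hD
  have hθ := connector_comp_eq hD er.toReflexiveRelation es.toReflexiveRelation (θ := θ)
    (by simpa using h₁ (leftLeg hD es.toReflexiveRelation) (by simp))
    (by simpa using h₂ (rightLeg hD er.toReflexiveRelation) (by simp)) X.p
    (by rw [← Pt.hom_p f, pullback.condition_assoc])
    (by rw [← Pt.hom_p g, pullback.condition_assoc])
  have hQ := IsPullback.of_hasPullback K.p L.p
  -- For k and l over the same base element, the triple (k, s p k, l) is composable because `f.hom`
  -- and `g.hom` send k and l to the zero sections.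
  let α : pullback K.p L.p ⟶ pullback f.hom f.hom :=
    pullback.lift (pullback.fst K.p L.p ≫ k.hom) (pullback.fst K.p L.p ≫ K.p ≫ X.s)
      (by simp [hf.w])
  let β : pullback K.p L.p ⟶ pullback g.hom g.hom :=
    pullback.lift (pullback.fst K.p L.p ≫ K.p ≫ X.s) (pullback.snd K.p L.p ≫ l.hom)
      (by simp [hg.w, pullback.condition_assoc])
  let δ := hD.lift α β (by simp [α, β])
  refine Pt.huqCommute_of_isPullback hQ (i := pullback.lift (𝟙 _) (K.p ≫ L.s) (by simp))
    (j := pullback.lift (L.p ≫ K.s) (𝟙 _) (by simp)) (by simp) (by simp) (by simp) (by simp)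
    (δ ≫ θ) (by simp [hθ, δ, α]) ?_ ?_
  · rw [← Category.assoc, h₁ _ (by simp [δ, β])]
    simp [δ, α]
  · rw [← Category.assoc, h₂ _ (by simp [δ, α])]
    simp [δ, β]

open ZeroObject in
lemma smithIsHuq_of_conditionC (h : ConditionC C) : SmithIsHuq C := by
  intro R S X r₁ r₂ s₁ s₂ hr hs hc
  obtain ⟨Y, f, hf⟩ := SemiAbelian.exact r₁ r₂ hr
  obtain ⟨Z, g, hg⟩ := SemiAbelian.exact s₁ s₂ hs
  obtain ⟨⟨er⟩⟩ := hr
  obtain ⟨⟨es⟩⟩ := hs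
  have jr := er.toJointlyMono₂
  have js := es.toJointlyMono₂
  obtain ⟨φ₀, φ₁, φ₂⟩ := hc.exists_prod
  have hcX : HuqCommute (relationInclusion er.toReflexiveRelation)
      (relationInclusion es.toReflexiveRelation) := by
    refine h (0 : (0 : C) ⟶ X) _ _ (nonempty_normalMono_relationInclusion hf _)
      (nonempty_normalMono_relationInclusion hg _) ?_
    let x : pullback r₁ (0 : (0 : C) ⟶ X) ⟶ kernel r₁ :=
      kernel.lift r₁ (pullback.fst _ _) (by simp [pullback.condition])
    let y : pullback s₁ (0 : (0 : C) ⟶ X) ⟶ kernel s₁ :=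
      kernel.lift s₁ (pullback.fst _ _) (by simp [pullback.condition])
    have hx : x ≫ normalisation r₁ r₂ = pullback.fst r₁ 0 ≫ r₂ := by simp [x, normalisation]
    have hy : y ≫ normalisation s₁ s₂ = pullback.fst s₁ 0 ≫ s₂ := by simp [y, normalisation]
    let c := prod.map x y ≫ φ₀
    -- In the fibre over 0 the first coordinate vanishes and the second carries the normalisations,
    -- which commute by `φ₀`.
    let d : pullback r₁ (0 : (0 : C) ⟶ X) ⨯ pullback s₁ (0 : (0 : C) ⟶ X) ⟶
        pullback (prod.fst : X ⨯ X ⟶ X) (0 : (0 : C) ⟶ X) :=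
      pullback.lift (prod.lift 0 c) 0 (by simp)
    have hi : prod.lift (𝟙 _) 0 ≫ d =
        Pt.pullbackMap 0 (relationInclusion er.toReflexiveRelation) := by
      apply pullback.hom_ext
      · rw [Pt.pullbackMap_fst]
        apply Limits.prod.hom_ext
        · simp [d, relationInclusion, pullback.condition]
        · have : prod.lift (𝟙 _) 0 ≫ c = pullback.fst r₁ 0 ≫ r₂ := by
            rw [← hx, ← φ₁]
            simp [c, ← Category.assoc, prod.comp_lift]
          simp [d, this, relationInclusion]
      · exact (isZero_zero C).eq_of_tgt _ _
    have hj : prod.lift 0 (𝟙 _) ≫ d =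
        Pt.pullbackMap 0 (relationInclusion es.toReflexiveRelation) := by
      apply pullback.hom_ext
      · rw [Pt.pullbackMap_fst]
        apply Limits.prod.hom_ext
        · simp [d, relationInclusion, pullback.condition]
        · have : prod.lift 0 (𝟙 _) ≫ c = pullback.fst s₁ 0 ≫ s₂ := by
            rw [← hy, ← φ₂]
            simp [c, ← Category.assoc, prod.comp_lift]
          simp [d, this, relationInclusion]
      · exact (isZero_zero C).eq_of_tgt _ _
    have hz {A A' : C} (p : A ⟶ (0 : C)) (s : (0 : C) ⟶ A') : p ≫ s = 0 := by
      rw [(isZero_zero C).eq_zero_of_tgt p, zero_comp]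
    have hprod : IsPullback prod.fst prod.snd (pullback.snd r₁ (0 : (0 : C) ⟶ X))
        (pullback.snd s₁ (0 : (0 : C) ⟶ X)) := by
      convert! IsPullback.of_is_product' (prodIsProd (pullback r₁ (0 : (0 : C) ⟶ X))
        (pullback s₁ (0 : (0 : C) ⟶ X))) (isZero_zero C).isTerminal <;>
        exact (isZero_zero C).eq_of_tgt _ _
    exact Pt.huqCommute_of_isPullback hprod
      (prod.lift_fst _ _) ((prod.lift_snd _ _).trans (hz _ _).symm)
      ((prod.lift_fst _ _).trans (hz _ _).symm) (prod.lift_snd _ _) d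
      ((isZero_zero C).eq_of_tgt _ _) hi hj
  obtain ⟨P, π₁, π₂, hP, i, j, φ, i₁, i₂, j₁, j₂, hi, hj⟩ : ∃ (P : C) (π₁ : P ⟶ R)
      (π₂ : P ⟶ S) (_ : IsPullback π₁ π₂ r₁ s₁) (i : R ⟶ P) (j : S ⟶ P) (φ : P ⟶ X ⨯ X),
      i ≫ π₁ = 𝟙 R ∧ i ≫ π₂ = r₁ ≫ es.r ∧ j ≫ π₁ = s₁ ≫ er.r ∧ j ≫ π₂ = 𝟙 S ∧
      i ≫ φ = prod.lift r₁ r₂ ∧ j ≫ φ = prod.lift s₁ s₂ := Pt.exists_of_huqCommute hcX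
  have hD := IsPullback.of_hasPullback r₂ s₁
  have σ₁ : er.s ≫ r₁ = r₂ := er.symmetry₁
  have σ₂ : er.s ≫ r₂ = r₁ := er.symmetry₂
  -- The triple (x, y, z) goes to the pairs (y, x) and (y, z), which share their first entry as `hP`
  -- requires.
  let ψ := hP.lift (pullback.fst r₂ s₁ ≫ er.s) (pullback.snd r₂ s₁)
    (by simp [σ₁, pullback.condition])
  have hl : leftLeg hD es.toReflexiveRelation ≫ ψ = er.s ≫ i := by
    apply hP.hom_ext <;> simp [ψ, i₁, i₂, reassoc_of% σ₁]
  have hr : rightLeg hD er.toReflexiveRelation ≫ ψ = j := by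
    have e : er.r ≫ er.s = er.r := er.right_cancellation _ _
      (by simp [σ₁]) (by simp [σ₂])
    apply hP.hom_ext <;> simp [ψ, j₁, j₂, e]
  refine Centralise.of_legs hD (leftLeg_fst hD es.toReflexiveRelation) (by simp) (by simp)
    (rightLeg_snd hD er.toReflexiveRelation) (ψ ≫ φ ≫ prod.snd) ?_ ?_
  · rw [reassoc_of% hl, reassoc_of% hi]
    simp [σ₂]
  · rw [reassoc_of% hr, reassoc_of% hj]
    simp

end ConditionC

/-! ### Connectors constructed from commuting kernels. -/

section Central

variable {C : Type u} [Category.{v} C] [HasZeroMorphisms C] [SemiAbelian C]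

/-- If the kernel of `h : L ⟶ Y` commutes with the identity of `L`, then the kernel pair of `h`
centralises the largest equivalence relation on `L`. -/
lemma exists_connector_of_kernel_central {L Y : C} (h : L ⟶ Y) (ψ : kernel h ⨯ L ⟶ L)
    (ψ₁ : prod.lift (𝟙 _) 0 ≫ ψ = kernel.ι h) (ψ₂ : prod.lift 0 (𝟙 L) ≫ ψ = 𝟙 L) :
    ∃ θ : pullback h h ⨯ L ⟶ L,
      (∀ ⦃T : C⦄ (x y : T ⟶ L) (e : x ≫ h = y ≫ h),
        prod.lift (pullback.lift x y e) y ≫ θ = x) ∧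
      (∀ ⦃T : C⦄ (x z : T ⟶ L), prod.lift (pullback.lift x x rfl) z ≫ θ = z) := by
  have hψ : ψ ≫ h = prod.snd ≫ h :=
    prod_hom_ext_of_sections (by simp [reassoc_of% ψ₁]) (by simp [reassoc_of% ψ₂])
  have hl {T : C} (z : T ⟶ kernel h) : prod.lift z (0 : T ⟶ L) ≫ ψ = z ≫ kernel.ι h := by
    rw [← ψ₁, ← Category.assoc, prod.comp_lift, Category.comp_id, comp_zero]
  have hr {T : C} (z : T ⟶ L) : prod.lift (0 : T ⟶ kernel h) z ≫ ψ = z := by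
    conv_rhs => rw [← Category.comp_id z, ← ψ₂, ← Category.assoc, prod.comp_lift, Category.comp_id,
      comp_zero]
  -- Write k·z for `ψ`. The map (k, z) ↦ (k·z, z) is a morphism of points over `L` inducing an
  -- isomorphism on fibres over 0, hence invertible.
  let j : kernel h ⨯ L ⟶ pullback h h := pullback.lift ψ prod.snd hψ
  have hj {T : C} (x : T ⟶ L) : prod.lift 0 x ≫ j = pullback.lift x x rfl := by
    apply pullback.hom_ext <;> simp [j, hr]
  let A : Pt L := ⟨kernel h ⨯ L, prod.snd, prod.lift 0 (𝟙 L), by simp⟩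
  let A' : Pt L := ⟨pullback h h, pullback.snd h h, pullback.lift (𝟙 L) (𝟙 L) rfl, by simp⟩
  let j' : A ⟶ A' := Pt.homMk j (pullback.lift_snd _ _ _) (hj _)
  have : IsIso j := by
    refine Pt.isIso_hom_of_kernel j' (fun T t t' ht ht' e ↦ ?_) (fun T t ht ↦ ?_)
    · have aux {w : T ⟶ kernel h ⨯ L} (hw : w ≫ prod.snd = 0) :
          w ≫ j ≫ pullback.fst h h = (w ≫ prod.fst) ≫ kernel.ι h := by
        rw [← hl]
        have : prod.lift (w ≫ prod.fst) 0 = w := by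
          apply Limits.prod.hom_ext <;> simp [hw]
        simp [j, this]
      apply Limits.prod.hom_ext
      · rw [← cancel_mono (kernel.ι h), ← aux ht, ← aux ht']
        exact (Category.assoc _ _ _).symm.trans ((congr($e ≫ pullback.fst h h)).trans
          (Category.assoc _ _ _))
      · exact ht.trans ht'.symm
    · change T ⟶ pullback h h at t
      change t ≫ pullback.snd h h = 0 at ht
      refine ⟨prod.lift (kernel.lift h (t ≫ pullback.fst h h) ?_) 0, ?_⟩
      · rw [Category.assoc, pullback.condition, reassoc_of% ht, zero_comp]
      · change _ ≫ j = t
        apply pullback.hom_ext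
        · simp [j, hl]
        · simp [j, ht]
  have hinv₁ : inv j ≫ ψ = pullback.fst h h := by simp [j]
  have hinv₂ : inv j ≫ prod.snd = pullback.snd h h := by simp [j]
  -- For x = k·y the connector returns k·z; when x = y the element k is 0.
  refine ⟨prod.lift (prod.fst ≫ inv j ≫ prod.fst) prod.snd ≫ ψ, fun T x y e ↦ ?_,
    fun T x z ↦ ?_⟩
  · have : prod.lift (pullback.lift x y e) y ≫ prod.lift (prod.fst ≫ inv j ≫ prod.fst) prod.snd =
        pullback.lift x y e ≫ inv j := by
      apply Limits.prod.hom_ext <;> simp [hinv₂]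
    rw [reassoc_of% this, hinv₁, pullback.lift_fst]
  · have : prod.lift (pullback.lift x x rfl) z ≫
        prod.lift (prod.fst ≫ inv j ≫ prod.fst) prod.snd = prod.lift 0 z := by
      apply Limits.prod.hom_ext
      · simp [← hj]
      · simp
    rw [reassoc_of% this, hr]

/-- If the kernels `k` of `f` and `l` of `g` commute, then the kernel pair of `l ≫ f` centralises
the largest equivalence relation on the kernel of `g`. -/
lemma exists_connector_of_commuting_kernels {K L X Y Z : C} {f : X ⟶ Y} {g : X ⟶ Z} {k : K ⟶ X}
    {l : L ⟶ X} [Mono l] (hk : ∀ ⦃T : C⦄ (t : T ⟶ X), t ≫ f = 0 → ∃ t', t' ≫ k = t)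
    (hlg : l ≫ g = 0) (hl : ∀ ⦃T : C⦄ (t : T ⟶ X), t ≫ g = 0 → ∃ t', t' ≫ l = t)
    {φ : K ⨯ L ⟶ X} (φ₁ : prod.lift (𝟙 K) 0 ≫ φ = k) (φ₂ : prod.lift 0 (𝟙 L) ≫ φ = l) :
    ∃ θ : pullback (l ≫ f) (l ≫ f) ⨯ L ⟶ L,
      (∀ ⦃T : C⦄ (x y : T ⟶ L) (e : x ≫ l ≫ f = y ≫ l ≫ f),
        prod.lift (pullback.lift x y e) y ≫ θ = x) ∧
      (∀ ⦃T : C⦄ (x z : T ⟶ L), prod.lift (pullback.lift x x rfl) z ≫ θ = z) := by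
  have hφ : φ ≫ g = prod.fst ≫ k ≫ g :=
    prod_hom_ext_of_sections (by simp [reassoc_of% φ₁]) (by simp [reassoc_of% φ₂, hlg])
  obtain ⟨ζ, hζ⟩ := hk (kernel.ι (l ≫ f) ≫ l) (by simp)
  -- The kernel of `l ≫ f` is the intersection of the two kernels; `ζ` places it in `K`, and `φ`
  -- restricted to it and `L` is killed by `g`.
  obtain ⟨ψ, hψ⟩ := hl (prod.lift (prod.fst ≫ ζ) prod.snd ≫ φ) (by
    rw [Category.assoc, hφ, prod.lift_fst_assoc, Category.assoc, reassoc_of% hζ, hlg, comp_zero,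
      comp_zero])
  refine exists_connector_of_kernel_central (l ≫ f) ψ ?_ ?_
  · have : prod.lift (𝟙 (kernel (l ≫ f))) 0 ≫ prod.lift (prod.fst ≫ ζ) (prod.snd : _ ⟶ L) =
        ζ ≫ prod.lift (𝟙 K) 0 := by
      apply Limits.prod.hom_ext <;> simp
    rw [← cancel_mono l, Category.assoc, hψ, reassoc_of% this, φ₁, hζ]
  · have : prod.lift 0 (𝟙 L) ≫ prod.lift ((prod.fst : kernel (l ≫ f) ⨯ L ⟶ _) ≫ ζ) prod.snd =
        prod.lift 0 (𝟙 L) := by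
      apply Limits.prod.hom_ext <;> simp
    rw [← cancel_mono l, Category.assoc, hψ, reassoc_of% this, φ₂, Category.id_comp]

/-- Since `φ ≫ f` depends only on the `L` coordinate and `φ ≫ g` only on the `K` coordinate, each
relation constrains one coordinate alone. On each factor the constrained relation centralises the
largest one. -/
lemma centralise_of_commuting_kernels {K L X Y Z : C} {f : X ⟶ Y} {g : X ⟶ Z} {k : K ⟶ X}
    {l : L ⟶ X} [Mono k] [Mono l] (hkf : k ≫ f = 0)
    (hk : ∀ ⦃T : C⦄ (t : T ⟶ X), t ≫ f = 0 → ∃ t', t' ≫ k = t)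
    (hlg : l ≫ g = 0) (hl : ∀ ⦃T : C⦄ (t : T ⟶ X), t ≫ g = 0 → ∃ t', t' ≫ l = t)
    {φ : K ⨯ L ⟶ X} (φ₁ : prod.lift (𝟙 K) 0 ≫ φ = k) (φ₂ : prod.lift 0 (𝟙 L) ≫ φ = l)
    {A : C} (j : K ⨯ L ⟶ A) [IsIso j] (m : A ⟶ X) (hjm : j ≫ m = φ)
    {R S : C} (r₁ r₂ : R ⟶ A) (s₁ s₂ : S ⟶ A) (hr : r₁ ≫ m ≫ f = r₂ ≫ m ≫ f)
    (hs : s₁ ≫ m ≫ g = s₂ ≫ m ≫ g) : Centralise r₁ r₂ s₁ s₂ := by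
  have hφg : φ ≫ g = prod.fst ≫ k ≫ g :=
    prod_hom_ext_of_sections (by simp [reassoc_of% φ₁]) (by simp [reassoc_of% φ₂, hlg])
  have hφf : φ ≫ f = prod.snd ≫ l ≫ f :=
    prod_hom_ext_of_sections (by simp [reassoc_of% φ₁, hkf]) (by simp [reassoc_of% φ₂])
  obtain ⟨θL, θL₁, θL₂⟩ := exists_connector_of_commuting_kernels hk hlg hl φ₁ φ₂
  have swap₁ : prod.lift (𝟙 L) 0 ≫ prod.lift prod.snd prod.fst ≫ φ = l := by
    rw [← φ₂, ← Category.assoc]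
    congr 1
    apply Limits.prod.hom_ext <;> simp
  have swap₂ : prod.lift 0 (𝟙 K) ≫ prod.lift prod.snd prod.fst ≫ φ = k := by
    rw [← φ₁, ← Category.assoc]
    congr 1
    apply Limits.prod.hom_ext <;> simp
  obtain ⟨θK, θK₁, θK₂⟩ := exists_connector_of_commuting_kernels hl hkf hk swap₁ swap₂
  let q₁ := inv j ≫ prod.fst
  let q₂ := inv j ≫ prod.snd
  have hm : m = inv j ≫ φ := by rw [← hjm, IsIso.inv_hom_id_assoc]
  have hr' : r₁ ≫ q₂ ≫ l ≫ f = r₂ ≫ q₂ ≫ l ≫ f := by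
    simpa [q₂, hm, hφf] using hr
  have hs' : s₁ ≫ q₁ ≫ k ≫ g = s₂ ≫ q₁ ≫ k ≫ g := by
    simpa [q₁, hm, hφg] using hs
  have hP := IsPullback.of_hasPullback r₂ s₁
  let a := pullback.fst r₂ s₁ ≫ r₁
  let b := pullback.fst r₂ s₁ ≫ r₂
  let c := pullback.snd r₂ s₁ ≫ s₂
  have hb : b = pullback.snd r₂ s₁ ≫ s₁ := pullback.condition
  have hab : (a ≫ q₂) ≫ l ≫ f = (b ≫ q₂) ≫ l ≫ f := by
    simp only [a, b, Category.assoc, hr']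
  have hcb : (c ≫ q₁) ≫ k ≫ g = (b ≫ q₁) ≫ k ≫ g := by
    simp only [hb, c, Category.assoc, hs']
  -- On `K` it is the pair (b, c) that is constrained, so `θK` is applied to the reversed triple (c,
  -- b, a).
  let U := prod.lift (pullback.lift (c ≫ q₁) (b ≫ q₁) hcb) (a ≫ q₁) ≫ θK
  let V := prod.lift (pullback.lift (a ≫ q₂) (b ≫ q₂) hab) (c ≫ q₂) ≫ θL
  have hU {T : C} (t : T ⟶ pullback r₂ s₁) : t ≫ U = prod.lift (pullback.lift (t ≫ c ≫ q₁)
      (t ≫ b ≫ q₁) (by simpa using t ≫= hcb)) (t ≫ a ≫ q₁) ≫ θK := by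
    rw [← Category.assoc]
    congr 1
    apply Limits.prod.hom_ext
    · apply pullback.hom_ext <;> simp
    · simp
  have hV {T : C} (t : T ⟶ pullback r₂ s₁) : t ≫ V = prod.lift (pullback.lift (t ≫ a ≫ q₂)
      (t ≫ b ≫ q₂) (by simpa using t ≫= hab)) (t ≫ c ≫ q₂) ≫ θL := by
    rw [← Category.assoc]
    congr 1
    apply Limits.prod.hom_ext
    · apply pullback.hom_ext <;> simp
    · simp
  have hj {T : C} (x : T ⟶ A) : prod.lift (x ≫ q₁) (x ≫ q₂) ≫ j = x := by
    have : prod.lift (x ≫ q₁) (x ≫ q₂) = x ≫ inv j := by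
      apply Limits.prod.hom_ext <;> simp [q₁, q₂]
    simp [this]
  refine ⟨_, _, _, hP, prod.lift U V ≫ j, fun T t ht ↦ ?_, fun T t ht ↦ ?_⟩
  · replace ht : t ≫ b = t ≫ c := by rw [hb]; exact ht
    have eU : t ≫ U = (t ≫ a) ≫ q₁ := by
      rw [hU]
      simp only [← Category.assoc, ht]
      exact θK₂ _ _
    have eV : t ≫ V = (t ≫ a) ≫ q₂ := by
      rw [hV]
      simp only [← Category.assoc, ← ht]
      exact θL₁ _ _ _
    rw [← Category.assoc, prod.comp_lift, eU, eV, hj]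
  · replace ht : t ≫ a = t ≫ b := ht
    have eU : t ≫ U = (t ≫ c) ≫ q₁ := by
      rw [hU]
      simp only [← Category.assoc, ht]
      exact θK₁ _ _ _
    have eV : t ≫ V = (t ≫ c) ≫ q₂ := by
      rw [hV]
      simp only [← Category.assoc, ht]
      exact θL₂ _ _
    rw [← Category.assoc, prod.comp_lift, eU, eV, hj]

end Central

/-! ### From (C̄) to (SH). -/

section ConditionCBar

variable {C : Type u} [Category.{v} C] [SemiAbelian C]

lemma ConditionCBar.exists_kernelPairs (h : ConditionCBar C) {E B : C} (e : E ⟶ B) {T U V : Pt B}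
    (u : T ⟶ U) (v : T ⟶ V)
    (H : ∀ ⦃R S : C⦄ (r₁ r₂ : R ⟶ pullback T.p e) (s₁ s₂ : S ⟶ pullback T.p e),
      r₁ ≫ pullback.fst T.p e ≫ u.hom = r₂ ≫ pullback.fst T.p e ≫ u.hom →
      s₁ ≫ pullback.fst T.p e ≫ v.hom = s₂ ≫ pullback.fst T.p e ≫ v.hom →
      Centralise r₁ r₂ s₁ s₂) :
    ∃ (R S : C) (r₁ r₂ : R ⟶ T.A) (s₁ s₂ : S ⟶ T.A), IsKernelPair u.hom r₁ r₂ ∧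
      IsKernelPair v.hom s₁ s₂ ∧ Centralise r₁ r₂ s₁ s₂ := by
  obtain ⟨R, r₁, r₂, hr⟩ := Pt.exists_isPullback_hom u u
  obtain ⟨S, s₁, s₂, hs⟩ := Pt.exists_isPullback_hom v v
  have er := isEquivalenceRelation_of_isKernelPair (Pt.isPullback_of_hom hr)
  have es := isEquivalenceRelation_of_isKernelPair (Pt.isPullback_of_hom hs)
  obtain ⟨⟨er'⟩⟩ := id er
  obtain ⟨⟨es'⟩⟩ := id es
  have := jointlyMono₂_changeOfBase e er'.toJointlyMono₂
  have := jointlyMono₂_changeOfBase e es'.toJointlyMono₂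
  have : JointlyMono₂ ((Pt.forget B).map r₁) ((Pt.forget B).map r₂) :=
    jointlyMono₂_hom er'.toJointlyMono₂
  have : JointlyMono₂ ((Pt.forget B).map s₁) ((Pt.forget B).map s₂) :=
    jointlyMono₂_hom es'.toJointlyMono₂
  refine ⟨R.A, S.A, r₁.hom, r₂.hom, s₁.hom, s₂.hom, hr, hs, Centralise.map (Pt.forget B)
    er'.toReflexiveRelation es'.toReflexiveRelation (h e r₁ r₂ s₁ s₂ er es
      (centralise_of_hom (er'.toReflexiveRelation.map _) (es'.toReflexiveRelation.map _)
        (H (Pt.pullbackMap e r₁) (Pt.pullbackMap e r₂) (Pt.pullbackMap e s₁) (Pt.pullbackMap e s₂)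
          ?_ ?_)))⟩
  · simp only [← Category.assoc, Pt.pullbackMap_fst]
    simp only [Category.assoc, hr.w]
  · simp only [← Category.assoc, Pt.pullbackMap_fst]
    simp only [Category.assoc, hs.w]

variable [HasZeroMorphisms C]

lemma normalisation_comp_eq_zero {R X Y : C} {r₁ r₂ : R ⟶ X} {f : X ⟶ Y}
    (hf : IsKernelPair f r₁ r₂) : normalisation r₁ r₂ ≫ f = 0 := by
  simp [normalisation, ← hf.w]

lemma exists_lift_normalisation {R X Y : C} {r₁ r₂ : R ⟶ X} {f : X ⟶ Y}
    (hf : IsKernelPair f r₁ r₂) ⦃T : C⦄ (t : T ⟶ X) (ht : t ≫ f = 0) :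
    ∃ t', t' ≫ normalisation r₁ r₂ = t :=
  ⟨kernel.lift r₁ (hf.lift 0 t (by simp [ht])) (by simp), by simp [normalisation]⟩

lemma mono_normalisation {R X : C} {r₁ r₂ : R ⟶ X} [JointlyMono₂ r₁ r₂] :
    Mono (normalisation r₁ r₂) where
  right_cancellation g h e := by
    rw [← cancel_mono (kernel.ι r₁)]
    refine JointlyMono₂.right_cancellation (p₁ := r₁) (p₂ := r₂) _ _ ?_ ?_
    · simp
    · simpa [normalisation] using e

open ZeroObject in
lemma smithIsHuq_of_conditionCBar (h : ConditionCBar C) : SmithIsHuq C := by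
  intro R S X r₁ r₂ s₁ s₂ hr hs hc
  obtain ⟨Y, f, hf⟩ := SemiAbelian.exact r₁ r₂ hr
  obtain ⟨Z, g, hg⟩ := SemiAbelian.exact s₁ s₂ hs
  obtain ⟨⟨er⟩⟩ := hr
  obtain ⟨⟨es⟩⟩ := hs
  have jr := er.toJointlyMono₂
  have js := es.toJointlyMono₂
  have ρ₁ : er.r ≫ r₁ = 𝟙 X := er.reflexivity₁
  have ρ₂ : er.r ≫ r₂ = 𝟙 X := er.reflexivity₂
  have σ₁ : es.r ≫ s₁ = 𝟙 X := es.reflexivity₁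
  have σ₂ : es.r ≫ s₂ = 𝟙 X := es.reflexivity₂
  obtain ⟨φ, φ₁, φ₂⟩ := hc.exists_prod
  have : Mono (normalisation r₁ r₂) := mono_normalisation
  have : Mono (normalisation s₁ s₂) := mono_normalisation
  have hkf := normalisation_comp_eq_zero hf
  have hlg := normalisation_comp_eq_zero hg
  have hφg : φ ≫ g = prod.fst ≫ normalisation r₁ r₂ ≫ g :=
    prod_hom_ext_of_sections (by simp [reassoc_of% φ₁]) (by simp [reassoc_of% φ₂, hlg])
  let T := pullback r₂ s₁
  let a : T ⟶ R := pullback.fst r₂ s₁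
  let b : T ⟶ S := pullback.snd r₂ s₁
  have hT : IsPullback a b r₂ s₁ := IsPullback.of_hasPullback r₂ s₁
  let m : T ⟶ X := b ≫ s₂
  let τ : X ⟶ T := hT.lift er.r es.r (by rw [ρ₂, σ₁])
  have τa : τ ≫ a = er.r := hT.lift_fst _ _ _
  have τb : τ ≫ b = es.r := hT.lift_snd _ _ _
  have τm : τ ≫ m = 𝟙 X := by simp only [m, reassoc_of% τb, σ₂]
  let Tp : Pt X := ⟨T, a ≫ r₁, τ, by rw [reassoc_of% τa, ρ₁]⟩
  -- On triples (x, y, z), `u` is (x, f z) and `v` is (x, g z); recording x keeps them over `X`.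
  let u : Tp ⟶ graphPt f := Pt.homMk (prod.lift (a ≫ r₁) (m ≫ f)) (prod.lift_fst _ _) (by
    change τ ≫ prod.lift (a ≫ r₁) (m ≫ f) = prod.lift (𝟙 X) f
    rw [prod.comp_lift, reassoc_of% τa, ρ₁, reassoc_of% τm])
  let v : Tp ⟶ graphPt g := Pt.homMk (prod.lift (a ≫ r₁) (m ≫ g)) (prod.lift_fst _ _) (by
    change τ ≫ prod.lift (a ≫ r₁) (m ≫ g) = prod.lift (𝟙 X) g
    rw [prod.comp_lift, reassoc_of% τa, ρ₁, reassoc_of% τm])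
  let A := pullback (a ≫ r₁) (0 : (0 : C) ⟶ X)
  let c : A ⟶ T := pullback.fst (a ≫ r₁) (0 : (0 : C) ⟶ X)
  have hcar : c ≫ a ≫ r₁ = 0 := pullback.condition.trans comp_zero
  have hAext {W : C} {x y : W ⟶ A} (ha : x ≫ c ≫ a = y ≫ c ≫ a)
      (hm : x ≫ c ≫ m = y ≫ c ≫ m) : x = y := by
    refine pullback.hom_ext (hT.hom_ext (by simpa using ha) (hg.hom_ext ?_ (by simpa using hm)))
      ((isZero_zero C).eq_of_tgt _ _)
    change ((x ≫ c) ≫ b) ≫ s₁ = ((y ≫ c) ≫ b) ≫ s₁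
    simp only [Category.assoc, ← hT.w]
    exact (by simpa using ha =≫ r₂)
  -- This is (k, l) ↦ (0, k, φ(k, l)), where k and φ(k, l) are related by `S` because `g` identifies
  -- them.
  let j : kernel r₁ ⨯ kernel s₁ ⟶ A := pullback.lift
    (hT.lift (prod.fst ≫ kernel.ι r₁) (hg.lift (prod.fst ≫ normalisation r₁ r₂) φ
      (by simp [hφg])) (by simp [normalisation])) 0 (by simp [a, hT.lift_fst_assoc])
  have hja : j ≫ c ≫ a = prod.fst ≫ kernel.ι r₁ := by
    simp only [j, c, pullback.lift_fst_assoc, hT.lift_fst]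
  have hjm : j ≫ c ≫ m = φ := by
    simp only [j, c, m, pullback.lift_fst_assoc, hT.lift_snd_assoc, hg.lift_snd]
  have : IsIso j := by
    let q : A ⟶ kernel r₁ := kernel.lift r₁ (c ≫ a) (by simpa using hcar)
    have hq : q ≫ kernel.ι r₁ = c ≫ a := kernel.lift_ι _ _ _
    have hjq : j ≫ q = prod.fst := by
      rw [← cancel_mono (kernel.ι r₁), Category.assoc, hq, hja]
    let M : Pt (kernel r₁) := ⟨_, prod.fst, prod.lift (𝟙 (kernel r₁)) (0 : _ ⟶ kernel s₁), by simp⟩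
    let N : Pt (kernel r₁) :=
      ⟨A, q, prod.lift (𝟙 (kernel r₁)) (0 : _ ⟶ kernel s₁) ≫ j, by simp [hjq]⟩
    let j' : M ⟶ N := Pt.homMk j hjq rfl
    refine Pt.isIso_hom_of_kernel j' (fun W t t' ht ht' e ↦ ?_) (fun W t ht ↦ ?_)
    · have aux {w : W ⟶ kernel r₁ ⨯ kernel s₁} (hw : w ≫ prod.fst = 0) :
          (w ≫ j) ≫ c ≫ m = (w ≫ prod.snd) ≫ normalisation s₁ s₂ := by
        have : w = (w ≫ prod.snd) ≫ prod.lift 0 (𝟙 _) := by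
          apply Limits.prod.hom_ext <;> simp [hw]
        rw [Category.assoc, hjm, this, Category.assoc, φ₂]
        simp
      apply Limits.prod.hom_ext
      · exact ht.trans ht'.symm
      · rw [← cancel_mono (normalisation s₁ s₂), ← aux ht, ← aux ht']
        exact congr($e ≫ c ≫ m)
    · change W ⟶ A at t
      change t ≫ q = 0 at ht
      have hta : t ≫ c ≫ a = 0 := by rw [← hq, reassoc_of% ht, zero_comp]
      have hts : (t ≫ c ≫ b) ≫ s₁ = 0 := by
        simp only [Category.assoc, ← hT.w]
        simpa using hta =≫ r₂
      refine ⟨kernel.lift s₁ (t ≫ c ≫ b) hts ≫ prod.lift 0 (𝟙 _), ?_⟩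
      change (_ ≫ _) ≫ j = t
      apply hAext
      · simp [hja, hta]
      · rw [Category.assoc, Category.assoc, hjm, φ₂]
        simp [normalisation, m]
  have key {R' S' : C} (r₁' r₂' : R' ⟶ A) (s₁' s₂' : S' ⟶ A)
      (hr' : r₁' ≫ (c ≫ m) ≫ f = r₂' ≫ (c ≫ m) ≫ f)
      (hs' : s₁' ≫ (c ≫ m) ≫ g = s₂' ≫ (c ≫ m) ≫ g) : Centralise r₁' r₂' s₁' s₂' :=
    centralise_of_commuting_kernels hkf (exists_lift_normalisation hf) hlg
      (exists_lift_normalisation hg) φ₁ φ₂ j (c ≫ m) hjm r₁' r₂' s₁' s₂' hr' hs'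
  obtain ⟨R', S', r₁', r₂', s₁', s₂', hu, hv, hcent⟩ : ∃ (R' S' : C) (r₁' r₂' : R' ⟶ T)
      (s₁' s₂' : S' ⟶ T), IsKernelPair (prod.lift (a ≫ r₁) (m ≫ f)) r₁' r₂' ∧
      IsKernelPair (prod.lift (a ≫ r₁) (m ≫ g)) s₁' s₂' ∧ Centralise r₁' r₂' s₁' s₂' := by
    refine h.exists_kernelPairs (0 : (0 : C) ⟶ X) u v (fun R' S' r₁' r₂' s₁' s₂' hr' hs' ↦
      key r₁' r₂' s₁' s₂' ?_ ?_)
    · have e : (r₁' ≫ c ≫ prod.lift (a ≫ r₁) (m ≫ f)) ≫ prod.snd =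
        (r₂' ≫ c ≫ prod.lift (a ≫ r₁) (m ≫ f)) ≫ prod.snd := congr($hr' ≫ prod.snd)
      simpa only [Category.assoc, prod.lift_snd] using e
    · have e : (s₁' ≫ c ≫ prod.lift (a ≫ r₁) (m ≫ g)) ≫ prod.snd =
        (s₂' ≫ c ≫ prod.lift (a ≫ r₁) (m ≫ g)) ≫ prod.snd := congr($hs' ≫ prod.snd)
      simpa only [Category.assoc, prod.lift_snd] using e
  obtain ⟨P, π₁, π₂, hP, Θ, h₁, h₂⟩ := hcent
  -- The endomorphism (x, y, z) ↦ (x, y, y) supplies the middle entry; `ρ` links it to (x, x, x)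
  -- under `u`, and `σ` links it to (x, y, z) under `v`.
  let i : T ⟶ T := hT.lift a (a ≫ r₂ ≫ es.r) (by simp [σ₁])
  have ia : i ≫ a = a := hT.lift_fst _ _ _
  have ib : i ≫ b = a ≫ r₂ ≫ es.r := hT.lift_snd _ _ _
  have im : i ≫ m = a ≫ r₂ := by simp only [m, reassoc_of% ib, σ₂, Category.comp_id]
  let ρ : T ⟶ R' := hu.lift ((a ≫ r₁) ≫ τ) i (by
    apply Limits.prod.hom_ext
    · simp [reassoc_of% τa, ρ₁, reassoc_of% ia]
    · simp [reassoc_of% τm, reassoc_of% im, hf.w])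
  let σ : T ⟶ S' := hv.lift i (𝟙 T) (by
    apply Limits.prod.hom_ext
    · simp [reassoc_of% ia]
    · simp only [Category.assoc, prod.lift_snd, reassoc_of% im, Category.id_comp]
      rw [reassoc_of% hT.w, hg.w, Category.assoc])
  have hρ₁ : ρ ≫ r₁' = (a ≫ r₁) ≫ τ := hu.lift_fst _ _ _
  have hρ₂ : ρ ≫ r₂' = i := hu.lift_snd _ _ _
  have hσ₁ : σ ≫ s₁' = i := hv.lift_fst _ _ _
  have hσ₂ : σ ≫ s₂' = 𝟙 T := hv.lift_snd _ _ _
  let δ : T ⟶ P := hP.lift ρ σ (hρ₂.trans hσ₁.symm)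
  have δ₁ : δ ≫ π₁ = ρ := hP.lift_fst _ _ _
  have δ₂ : δ ≫ π₂ = σ := hP.lift_snd _ _ _
  -- If y = z, `Θ` returns (x, x, x); if x = y, it returns (x, y, z). The last entry is then x or z
  -- respectively.
  refine ⟨T, a, b, hT, δ ≫ Θ ≫ m, fun W t ht ↦ ?_, fun W t ht ↦ ?_⟩
  · have e : t ≫ i = t := by
      refine hT.hom_ext (by rw [Category.assoc, ia]) (hg.hom_ext ?_ ?_)
      · simp only [Category.assoc, reassoc_of% ib, σ₁, Category.comp_id, hT.w]
      · simp only [Category.assoc, reassoc_of% ib, σ₂, Category.comp_id, ← ht, hT.w]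
    have e' := h₁ (t ≫ δ) (by
      simp only [Category.assoc, reassoc_of% δ₂, hσ₁, hσ₂, e, Category.comp_id])
    simp only [Category.assoc, reassoc_of% δ₁, hρ₁] at e'
    have e'' := e' =≫ m
    simpa only [Category.assoc, τm, Category.comp_id] using e''
  · have e : t ≫ (a ≫ r₁) ≫ τ = t ≫ i := by
      refine hT.hom_ext ?_ ?_
      · refine hf.hom_ext ?_ ?_
        · simp only [Category.assoc, reassoc_of% τa, ρ₁, ia, Category.comp_id]
        · simp only [Category.assoc, reassoc_of% τa, ρ₂, ia, Category.comp_id, ht]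
      · simp only [Category.assoc, τb, ib, reassoc_of% ht]
    have e' := h₂ (t ≫ δ) (by simp only [Category.assoc, reassoc_of% δ₁, hρ₁, hρ₂, ← e])
    simp only [Category.assoc, reassoc_of% δ₂, hσ₂, Category.comp_id] at e'
    have e'' := e' =≫ m
    simpa only [Category.assoc, m] using e''

end ConditionCBar

end SmithHuq

open SmithHuq in
theorem theorem1p1 (C : Type u) [Category.{v} C] [HasZeroMorphisms C] [SmithHuq.SemiAbelian C] :
    List.TFAE
      [SmithHuq.SmithIsHuq C,
       SmithHuq.ConditionC C,
       SmithHuq.ConditionCBar C,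
       SmithHuq.BasicReflectsCentralisation C] := by
  tfae_have 1 → 2 := conditionC_of_smithIsHuq C
  tfae_have 2 → 1 := smithIsHuq_of_conditionC C
  tfae_have 1 → 4 := basicReflectsCentralisation_of_smithIsHuq C
  tfae_have 4 → 3 := conditionCBar_of_basicReflectsCentralisation C
  tfae_have 3 → 1 := smithIsHuq_of_conditionCBar
  tfae_finish
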